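/- Let $\sigma<0$ and $\lambda>0$. For $L>0$ let $\epsilon_L(0)<\epsilon_L(1)<\epsilon_L(2)<\cdots$ be the eigenvalues (all simple) of $-\frac{d^2}{dx^2}$ on $[-L/2,L/2]$ with the attractive boundary conditions $\phi'(-L/2)=\sigma\phi(-L/2)$ and $\phi'(L/2)=-\sigma\phi(L/2)$. On the boson Fock space over $L^2([-L/2,L/2])$ let $a_k^*,a_k$ be the creation and annihilation operators of the normalized eigenfunction of $\epsilon_L(k)$, and put $N_k=a_k^*a_k$, $N_L=\sum_{k\ge 0}N_k$, $\tilde N_L=\sum_{k\ge 2}N_k$ and $$H_L=\sum_{k\ge 0}\epsilon_L(k)\,a_k^*a_k+\frac{\lambda}{2}\,\frac{\tilde N_L^2}{L}.$$ For $\beta>0$ and a chemical potential $\mu_L$ the grand canonical equilibrium state is $$\omega_L(X)=\frac{\operatorname{Tr}\,X e^{-\beta(H_L-\mu_LN_L)}}{\operatorname{Tr}\,e^{-\beta(H_L-\mu_LN_L)}}.$$ The total density $\rho>0$ is kept fixed: for all large $L$, $\mu_L$ is a chemical potential for which the traces $\operatorname{Tr}\,e^{-\beta(H_L-\mu_LN_L)}$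 and $\operatorname{Tr}\,N_Le^{-\beta(H_L-\mu_LN_L)}$ converge and $\omega_L(N_L)/L=\rho$. Then, for $L|\sigma|>2$, one has $\epsilon_L(0)<\epsilon_L(1)<0<\epsilon_L(k)$ for all $k\ge 2$. For all $\beta>0$ and $\rho>0$ the condensate density $$\rho_{cond}=\rho_{cond}(\beta,\rho)=\lim_{L\to\infty}\frac1L\,\omega_L(N_0+N_1)$$ exists (and depends, for given $\sigma,\lambda$, only on $\beta$ and $\rho$), the integral below converges, and $$\rho_{cond}\ \ge\ \rho-\frac1\pi\int_0^\infty\frac{dk}{e^{\beta(k^2+\sigma^2)}-1}.$$ Consequently, for each $\beta>0$ one has $\rho_{cond}(\beta,\rho)>0$ for all sufficiently large $\rho$, and for each $\rho>0$ one has $\rho_{cond}(\beta,\rho)>0$ for all sufficiently large $\beta$. The condensate is localized in the two negative-energy levels $k=0,1$: no other level is macroscopically occupied, that is, $\sup_{k\ge 2}\frac1L\,\omega_L(N_k)\to 0$ as $L\to\infty$. -/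

import Mathlib

open Filter Topology MeasureTheory

noncomputable section

namespace ImperfectBoseGas

/-! ### One-particle energies -/

/-- `e` is an eigenvalue of `-d²/dx²` on `[-L/2, L/2]` with the boundary conditions
`φ' - σ φ = 0` at `-L/2` and `φ' + σ φ = 0` at `L/2`
(attractive when `σ < 0`); `φ'` is the derivative of `φ`, one-sided at the end points. -/
def IsEnergyLevel (σ L e : ℝ) : Prop :=
  ∃ φ φ' : ℝ → ℝ,
    (∀ x ∈ Set.Icc (-(L / 2)) (L / 2),
      HasDerivWithinAt φ (φ' x) (Set.Icc (-(L / 2)) (L / 2)) x) ∧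
    (∀ x ∈ Set.Icc (-(L / 2)) (L / 2),
      HasDerivWithinAt φ' (-(e * φ x)) (Set.Icc (-(L / 2)) (L / 2)) x) ∧
    φ' (-(L / 2)) - σ * φ (-(L / 2)) = 0 ∧
    φ' (L / 2) + σ * φ (L / 2) = 0 ∧
    ∃ x ∈ Set.Icc (-(L / 2)) (L / 2), φ x ≠ 0

/-- The energy levels in increasing order, `energy σ L 0 < energy σ L 1 < ⋯`: each one is the
least eigenvalue above the previous one.  All the eigenvalues of this problem are simple, so there
is exactly one mode per eigenvalue. -/
def energy (σ L : ℝ) : ℕ → ℝ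
  | 0 => sInf {e | IsEnergyLevel σ L e}
  | k + 1 => sInf {e | IsEnergyLevel σ L e ∧ energy σ L k < e}

/-! ### Boson Fock space in the occupation number representation -/

/-- Occupation numbers of the modes `k = 0, 1, 2, …`, with finitely many particles. -/
abbrev Occupation := ℕ →₀ ℕ

/-- The linear span of the orthonormal occupation number vectors `|n⟩`, where mode `k` is the
normalized eigenfunction of the `k`-th energy level.  Its completion `ℓ²(Occupation)` is the boson
Fock space over `L²([-L/2, L/2])`; all the operators below are defined on this common dense
invariant domain. -/
abbrev FockCore := Occupation →₀ ℂ

/-- Operators on the common domain. -/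
abbrev FockOp := Module.End ℂ FockCore

/-- The occupation number vector `|n⟩`. -/
def ket (n : Occupation) : FockCore := Finsupp.single n 1

/-- The annihilation operator `a_k |n⟩ = √(n_k) |n - δ_k⟩` (it is `0` when `n_k = 0`). -/
def annihilate (k : ℕ) : FockOp :=
  Finsupp.linearCombination ℂ fun n : Occupation =>
    ((Real.sqrt (n k) : ℝ) : ℂ) • ket (n - Finsupp.single k 1)

/-- The creation operator `a_k^* |n⟩ = √(n_k + 1) |n + δ_k⟩`. -/
def create (k : ℕ) : FockOp :=
  Finsupp.linearCombination ℂ fun n : Occupation =>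
    ((Real.sqrt (n k + 1) : ℝ) : ℂ) • ket (n + Finsupp.single k 1)

/-- The number operator `N_k = a_k^* a_k`. -/
def number (k : ℕ) : FockOp := create k * annihilate k

/-- The operator `∑_k c_k a_k^* a_k`; on each vector `|n⟩` only finitely many terms are
nonzero. -/
def modeSum (c : ℕ → ℝ) : FockOp :=
  Finsupp.linearCombination ℂ fun n : Occupation => ∑ᶠ k : ℕ, (c k : ℂ) • number k (ket n)

/-- The kinetic energy `T = ∑_k ε_L(k) a_k^* a_k`. -/
def kinetic (σ L : ℝ) : FockOp := modeSum (energy σ L)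

/-- The total particle number `N = ∑_k a_k^* a_k`. -/
def totalNumber : FockOp := modeSum fun _ => 1

/-- The particle number in the positive-energy modes, `Ñ = ∑_{k ≥ 2} a_k^* a_k`. -/
def excitedNumber : FockOp := modeSum fun k => if 2 ≤ k then 1 else 0

/-- The Hamiltonian `H = T + (lam / 2) Ñ² / L`. -/
def hamiltonian (σ lam L : ℝ) : FockOp :=
  kinetic σ L + ((lam / (2 * L) : ℝ) : ℂ) • excitedNumber ^ 2

/-! ### The grand canonical state -/

/-- The diagonal matrix element `⟨n| X e^A |n⟩`, with `e^A |n⟩ = ∑_j A^j |n⟩ / j!`. -/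
def diagExp (X A : FockOp) (n : Occupation) : ℂ :=
  ∑' j : ℕ, ((j.factorial : ℂ)⁻¹) * (X ((A ^ j) (ket n))) n

/-- The trace `Tr (X e^A) = ∑_n ⟨n| X e^A |n⟩` over the Fock space. -/
def traceExp (X A : FockOp) : ℂ := ∑' n : Occupation, diagExp X A n

/-- The grand canonical equilibrium state
`ω_L(X) = Tr (X e^{-β (H - μ N)}) / Tr e^{-β (H - μ N)}`. -/
def gibbs (σ lam β μ L : ℝ) (X : FockOp) : ℂ :=
  traceExp X (-(β : ℂ) • (hamiltonian σ lam L - (μ : ℂ) • totalNumber)) /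
    traceExp 1 (-(β : ℂ) • (hamiltonian σ lam L - (μ : ℂ) • totalNumber))

/-- `μ` is the chemical potential of the system of length `L` at density `ρ`: the grand canonical
state exists (both traces below converge) and `ω_L(N) / L = ρ`. -/
def IsChemicalPotential (σ lam β ρ L μ : ℝ) : Prop :=
  Summable (diagExp 1 (-(β : ℂ) • (hamiltonian σ lam L - (μ : ℂ) • totalNumber))) ∧
  Summable (diagExp totalNumber (-(β : ℂ) • (hamiltonian σ lam L - (μ : ℂ) • totalNumber))) ∧
  gibbs σ lam β μ L totalNumber / (L : ℂ) = (ρ : ℂ)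

end ImperfectBoseGas

end

/-! Every operator involved is diagonal in the occupation basis, so the state is a classical weight
on occupations, `exp (-β (∑ (ε_k - μ) n_k + (lam / 2L) Ñ²))`. Modes 0 and 1 do not feel the
repulsion, so convergence of the partition function along multiples of the ground mode forces `μ <
ε_L(0)`. The secular equations give `ε_L(0) < -σ²` with `ε_L(0) → -σ²`. Hence `μ_L < -σ²`, and the
modes `k ≥ 2`, whose energies are positive, stay at distance at least `σ²` from `μ_L`.

Let `D(ν)` be the ideal-gas density. Completing the square in `Ñ` around `L x` turns the weight into
a product of geometric weights with positive energies raised by `lam x`, times the Gaussian `exp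
(-(β lam / 2L) (Ñ - L x)²)`. If `x = D(μ - lam x)`, the product weight has mean `Ñ` equal to `L x +
O(1)`, because the positive levels interlace with the squares of the multiples of `π / L`, and its
variance is `O(L)`. A Gaussian tilt of rate `O(1/L)` then moves the mean by only `O(√L)`, so the
excited density is `x(μ_L) + o(1)` (`abs_gibbsMean_excitedCount_sub_le`).

The condensate takes the remaining density `ρ - x(μ_L)`. Either `μ_L` stays a fixed distance below
`-σ²`, and then modes 0 and 1 hold boundedly many particles, or `μ_L` is close to `-σ²`, and then
`x(μ_L)` is close to `x_c = x(-σ²)`. Together with the monotonicity of `x` this yields the limit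
`max 0 (ρ - x_c)`. Since `x_c ≤ D(-σ²)`, the lower bound follows, and positivity with it because
`D(-σ²)` is finite and is `O(1/β)` at low temperature. -/

namespace ImperfectBoseGas

/-! ### Diagonal operators: reduction of Fock-space traces to real sums over occupations -/

/-- The weighted particle number `∑_k c_k n_k` of an occupation. -/
noncomputable def weightedCount (c : ℕ → ℝ) (n : Occupation) : ℝ := n.sum fun k j => c k * j

/-- The operator that acts on `|n⟩` by the scalar `x n`. -/
def ActsDiagonally (X : FockOp) (x : Occupation → ℝ) : Prop :=
  ∀ n, X (ket n) = (x n : ℂ) • ket n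

theorem ActsDiagonally.add {X Y : FockOp} {x y : Occupation → ℝ} (hX : ActsDiagonally X x)
    (hY : ActsDiagonally Y y) : ActsDiagonally (X + Y) fun n => x n + y n := by
  intro n
  rw [LinearMap.add_apply, hX n, hY n, ← add_smul]
  push_cast
  rfl

theorem ActsDiagonally.sub {X Y : FockOp} {x y : Occupation → ℝ} (hX : ActsDiagonally X x)
    (hY : ActsDiagonally Y y) : ActsDiagonally (X - Y) fun n => x n - y n := by
  intro n
  rw [LinearMap.sub_apply, hX n, hY n, ← sub_smul]
  push_cast
  rfl

theorem ActsDiagonally.smul {X : FockOp} {x : Occupation → ℝ} (hX : ActsDiagonally X x) (c : ℝ) :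
    ActsDiagonally ((c : ℂ) • X) fun n => c * x n := by
  intro n
  rw [LinearMap.smul_apply, hX n, smul_smul]
  push_cast
  rfl

theorem ActsDiagonally.pow {X : FockOp} {x : Occupation → ℝ} (hX : ActsDiagonally X x) (j : ℕ) :
    ActsDiagonally (X ^ j) fun n => x n ^ j := by
  intro n
  induction j with
  | zero => simp
  | succ j ih =>
    rw [pow_succ', Module.End.mul_apply, ih, map_smul, hX n, smul_smul]
    push_cast
    rw [pow_succ]

theorem actsDiagonally_one : ActsDiagonally 1 fun _ => 1 := by
  intro n
  simp

theorem actsDiagonally_number (k : ℕ) : ActsDiagonally (number k) fun n => (n k : ℝ) := by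
  intro n
  simp only [number, Module.End.mul_apply, annihilate, create, ket,
    Finsupp.linearCombination_single, one_smul, map_smul]
  rcases Nat.eq_zero_or_pos (n k) with h | h
  · simp [h]
  · have h1 : n - Finsupp.single k 1 + Finsupp.single k 1 = n :=
      tsub_add_cancel_of_le (Finsupp.single_le_iff.mpr h)
    have h2 : (((n - Finsupp.single k 1 : Occupation) k : ℕ) : ℝ) + 1 = n k := by
      rw [Finsupp.tsub_apply, Finsupp.single_eq_same, Nat.cast_sub h]
      simp
    rw [h1, h2, smul_smul, ← Complex.ofReal_mul, Real.mul_self_sqrt (Nat.cast_nonneg _)]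

theorem actsDiagonally_modeSum (c : ℕ → ℝ) : ActsDiagonally (modeSum c) (weightedCount c) := by
  intro n
  have h : ∀ k : ℕ, (c k : ℂ) • number k (ket n) = ((c k * n k : ℝ) : ℂ) • ket n := fun k => by
    rw [actsDiagonally_number k n, smul_smul]
    push_cast
    rfl
  have h0 : modeSum c (ket n) = ∑ᶠ k : ℕ, (c k : ℂ) • number k (ket n) := by
    simp [modeSum, ket]
  rw [h0, finsum_congr h, finsum_eq_sum_of_support_subset (s := n.support), ← Finset.sum_smul,
    weightedCount, Finsupp.sum, Complex.ofReal_sum]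
  intro k hk
  simp only [Function.mem_support] at hk
  simp only [Finset.mem_coe, Finsupp.mem_support_iff]
  rintro h
  exact hk (by simp [h])

/-- The indicator of the positive-energy modes. -/
noncomputable def excitedIndicator (k : ℕ) : ℝ := if 2 ≤ k then 1 else 0

/-- The exponent `-β (∑_k (ε_k - μ) n_k + (lam / 2L) Ñ²)` of the Gibbs weight. -/
noncomputable def gibbsExponent (σ lam β μ L : ℝ) (n : Occupation) : ℝ :=
  -β * (weightedCount (energy σ L) n + lam / (2 * L) * weightedCount excitedIndicator n ^ 2
    - μ * weightedCount (fun _ => 1) n)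

theorem actsDiagonally_exponent (σ lam β μ L : ℝ) :
    ActsDiagonally (-(β : ℂ) • (hamiltonian σ lam L - (μ : ℂ) • totalNumber))
      (gibbsExponent σ lam β μ L) := by
  have h := (((actsDiagonally_modeSum (energy σ L)).add
    (((actsDiagonally_modeSum excitedIndicator).pow 2).smul (lam / (2 * L)))).sub
    ((actsDiagonally_modeSum fun _ => 1).smul μ)).smul (-β)
  rw [Complex.ofReal_neg] at h
  exact h

/-- On an occupation vector the power series of the exponential operator is the scalar exponential
series, so traces become ordinary sums. -/
theorem diagExp_eq {X A : FockOp} {x a : Occupation → ℝ} (hX : ActsDiagonally X x)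
    (hA : ActsDiagonally A a) (n : Occupation) :
    diagExp X A n = ((x n * Real.exp (a n) : ℝ) : ℂ) := by
  have h : ∀ j : ℕ, ((j.factorial : ℂ)⁻¹) * (X ((A ^ j) (ket n))) n
      = (x n : ℂ) * ((a n : ℂ) ^ j / j.factorial) := fun j => by
    rw [hA.pow j n, map_smul, hX n]
    simp [ket]
    ring
  rw [diagExp, tsum_congr h, tsum_mul_left, Complex.ofReal_mul, Complex.ofReal_exp,
    Complex.exp_eq_exp_ℂ, NormedSpace.exp_eq_tsum_div]

theorem traceExp_eq {X A : FockOp} {x a : Occupation → ℝ} (hX : ActsDiagonally X x)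
    (hA : ActsDiagonally A a) :
    traceExp X A = ((∑' n, x n * Real.exp (a n) : ℝ) : ℂ) := by
  rw [traceExp, tsum_congr (diagExp_eq hX hA), Complex.ofReal_tsum]

theorem summable_diagExp_iff {X A : FockOp} {x a : Occupation → ℝ} (hX : ActsDiagonally X x)
    (hA : ActsDiagonally A a) :
    Summable (diagExp X A) ↔ Summable fun n => x n * Real.exp (a n) := by
  rw [funext (diagExp_eq hX hA), Complex.summable_ofReal]

theorem gibbs_eq {X : FockOp} {x : Occupation → ℝ} (hX : ActsDiagonally X x)
    (σ lam β μ L : ℝ) :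
    gibbs σ lam β μ L X =
      (((∑' n, x n * Real.exp (gibbsExponent σ lam β μ L n)) /
        ∑' n, Real.exp (gibbsExponent σ lam β μ L n) : ℝ) : ℂ) := by
  have hA := actsDiagonally_exponent σ lam β μ L
  rw [gibbs, traceExp_eq hX hA, traceExp_eq actsDiagonally_one hA]
  simp

/-! ### Product weights on occupations -/

/-- The geometric product weight `∏_k t_k ^ n_k`. -/
noncomputable def productWeight (t : ℕ → ℝ) (n : Occupation) : ℝ := n.prod fun k j => t k ^ j

theorem productWeight_nonneg {t : ℕ → ℝ} (ht : ∀ k, 0 ≤ t k) (n : Occupation) :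
    0 ≤ productWeight t n :=
  Finset.prod_nonneg fun k _ => pow_nonneg (ht k) _

theorem productWeight_zero (t : ℕ → ℝ) : productWeight t 0 = 1 := Finsupp.prod_zero_index

theorem productWeight_add_single (t : ℕ → ℝ) (n : Occupation) (k : ℕ) :
    productWeight t (n + Finsupp.single k 1) = t k * productWeight t n := by
  rw [productWeight, Finsupp.prod_add_index' (fun _ => pow_zero _) (fun _ _ _ => pow_add _ _ _),
    Finsupp.prod_single_index (h := fun k j => t k ^ j) (pow_zero _), pow_one, mul_comm,
    productWeight]

theorem productWeight_eq_exp (e : ℕ → ℝ) (n : Occupation) :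
    productWeight (fun k => Real.exp (e k)) n = Real.exp (weightedCount e n) := by
  rw [productWeight, weightedCount, Finsupp.sum, Real.exp_sum]
  refine Finset.prod_congr rfl fun k _ => ?_
  rw [mul_comm, Real.exp_nat_mul]

theorem weightedCount_add (c d : ℕ → ℝ) (n : Occupation) :
    weightedCount (fun k => c k + d k) n = weightedCount c n + weightedCount d n := by
  simp only [weightedCount, add_mul, Finsupp.sum, Finset.sum_add_distrib]

theorem weightedCount_smul (r : ℝ) (d : ℕ → ℝ) (n : Occupation) :
    weightedCount (fun k => r * d k) n = r * weightedCount d n := by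
  simp only [weightedCount, mul_assoc, Finsupp.sum, Finset.mul_sum]

theorem weightedCount_nonneg {c : ℕ → ℝ} (hc : ∀ k, 0 ≤ c k) (n : Occupation) :
    0 ≤ weightedCount c n :=
  Finset.sum_nonneg fun k _ => mul_nonneg (hc k) (Nat.cast_nonneg _)

theorem weightedCount_mono {c d : ℕ → ℝ} (h : ∀ k, c k ≤ d k) (n : Occupation) :
    weightedCount c n ≤ weightedCount d n :=
  Finset.sum_le_sum fun k _ => mul_le_mul_of_nonneg_right (h k) (Nat.cast_nonneg _)

theorem weightedCount_single (c : ℕ → ℝ) (k j : ℕ) :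
    weightedCount c (Finsupp.single k j) = c k * j := by
  simp [weightedCount]

theorem weightedCount_add_single (c : ℕ → ℝ) (n : Occupation) (k : ℕ) :
    weightedCount c (n + Finsupp.single k 1) = weightedCount c n + c k := by
  rw [weightedCount, Finsupp.sum_add_index' (by simp) (by intros; push_cast; ring),
    Finsupp.sum_single_index (by simp), weightedCount, Nat.cast_one, mul_one]

theorem apply_le_weightedCount_one (n : Occupation) (k : ℕ) :
    (n k : ℝ) ≤ weightedCount (fun _ => 1) n := by
  by_cases hk : k ∈ n.support
  · have := Finset.single_le_sum (f := fun k => (1 : ℝ) * (n k : ℝ)) (s := n.support)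
      (fun i _ => by positivity) hk
    simpa [weightedCount, Finsupp.sum] using this
  · rw [Finsupp.notMem_support_iff.mp hk]
    simpa using weightedCount_nonneg (c := fun _ => 1) (fun _ => zero_le_one) n

theorem hasSum_weightedCount (c : ℕ → ℝ) (n : Occupation) :
    HasSum (fun k => c k * (n k : ℝ)) (weightedCount c n) :=
  hasSum_sum_of_ne_finset_zero fun k hk => by simp [Finsupp.notMem_support_iff.mp hk]

theorem summable_div_one_sub {t : ℕ → ℝ} (ht : ∀ k, 0 ≤ t k) (hs : Summable t) :
    Summable fun k => t k / (1 - t k) := by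
  have h : ∀ᶠ k in cofinite, t k ≤ 1 / 2 := by
    rw [Nat.cofinite_eq_atTop]
    exact hs.tendsto_atTop_zero.eventually_le_const (by norm_num)
  refine Summable.of_norm_bounded_eventually (hs.mul_left 2) (h.mono fun k hk => ?_)
  rw [Real.norm_of_nonneg (div_nonneg (ht k) (by linarith)), div_le_iff₀ (by linarith)]
  nlinarith [ht k]

/-- A finite set of occupations lies in a box of finitely many modes and bounded numbers. There the
sum factors into truncated geometric series, each at most `1 / (1 - t) = 1 + t / (1 - t) ≤ exp (t /
(1 - t))`. -/
theorem sum_productWeight_le {t : ℕ → ℝ} (ht : ∀ k, 0 ≤ t k) (ht1 : ∀ k, t k < 1)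
    (hs : Summable t) (u : Finset Occupation) :
    ∑ n ∈ u, productWeight t n ≤ Real.exp (∑' k, t k / (1 - t k)) := by
  classical
  obtain ⟨K, hK⟩ : ∃ K : Finset ℕ, ∀ n ∈ u, n.support ⊆ K :=
    ⟨u.biUnion fun n => n.support, fun n hn => Finset.subset_biUnion_of_mem _ hn⟩
  obtain ⟨J, hJ⟩ : ∃ J : ℕ, ∀ n ∈ u, ∀ k, n k < J := by
    refine ⟨(u.sup fun n => n.support.sup n) + 1, fun n hn k => Nat.lt_succ_of_le ?_⟩
    refine le_trans ?_ (Finset.le_sup (f := fun n : Occupation => n.support.sup n) hn)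
    by_cases hk : k ∈ n.support
    · exact Finset.le_sup hk
    · simp [Finsupp.notMem_support_iff.mp hk]
  have hsub : u ⊆ K.finsupp fun _ => Finset.range J := fun n hn =>
    Finset.mem_finsupp_iff.mpr ⟨hK n hn, fun k _ => Finset.mem_range.mpr (hJ n hn k)⟩
  have hprod : ∑ n ∈ K.finsupp (fun _ => Finset.range J), productWeight t n
      = ∏ k ∈ K, ∑ j ∈ Finset.range J, t k ^ j := by
    rw [Finset.prod_sum, Finset.finsupp, Finset.sum_map]
    refine Finset.sum_congr (by ext; simp) fun p _ => ?_
    have hp : (Finsupp.indicator K p).support ⊆ K := Finsupp.support_indicator_subset _ _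
    change productWeight t (Finsupp.indicator K p) = _
    rw [productWeight, Finsupp.prod_of_support_subset _ hp _ (fun _ _ => pow_zero _),
      ← Finset.prod_attach K]
    refine Finset.prod_congr rfl fun k _ => ?_
    rw [Finsupp.indicator_of_mem k.2]
  calc ∑ n ∈ u, productWeight t n
      ≤ ∑ n ∈ K.finsupp (fun _ => Finset.range J), productWeight t n :=
        Finset.sum_le_sum_of_subset_of_nonneg hsub fun n _ _ => productWeight_nonneg ht n
    _ = ∏ k ∈ K, ∑ j ∈ Finset.range J, t k ^ j := hprod
    _ ≤ ∏ k ∈ K, Real.exp (t k / (1 - t k)) := by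
        refine Finset.prod_le_prod
          (fun k _ => Finset.sum_nonneg fun j _ => pow_nonneg (ht k) _) fun k _ => ?_
        have h1 : 0 < 1 - t k := by linarith [ht1 k]
        calc ∑ j ∈ Finset.range J, t k ^ j ≤ (1 - t k)⁻¹ := by
              rw [← tsum_geometric_of_lt_one (ht k) (ht1 k)]
              exact (summable_geometric_of_lt_one (ht k) (ht1 k)).sum_le_tsum _
                fun j _ => pow_nonneg (ht k) _
          _ = t k / (1 - t k) + 1 := by field_simp; ring
          _ ≤ _ := Real.add_one_le_exp _
    _ = Real.exp (∑ k ∈ K, t k / (1 - t k)) := (Real.exp_sum _ _).symm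
    _ ≤ _ := by
        refine Real.exp_le_exp.mpr ((summable_div_one_sub ht hs).sum_le_tsum _ fun k _ => ?_)
        exact div_nonneg (ht k) (by linarith [ht1 k])

theorem summable_productWeight {t : ℕ → ℝ} (ht : ∀ k, 0 ≤ t k) (ht1 : ∀ k, t k < 1)
    (hs : Summable t) : Summable (productWeight t) :=
  summable_of_sum_le (productWeight_nonneg ht) (sum_productWeight_le ht ht1 hs)

/-- Uniform room below 1 allows all weights to be multiplied by a common factor greater than 1 while
remaining summable; this is what absorbs polynomial moments. -/
theorem exists_uniform_bound_lt_one {t : ℕ → ℝ} (ht1 : ∀ k, t k < 1) (hs : Summable t) :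
    ∃ q < 1, 0 < q ∧ ∀ k, t k ≤ q := by
  obtain ⟨K, hK⟩ := eventually_atTop.mp
    (hs.tendsto_atTop_zero.eventually_le_const (show (0 : ℝ) < 1 / 2 by norm_num))
  have : ∀ K : ℕ, ∃ q < (1 : ℝ), 1 / 2 ≤ q ∧ ∀ k < K, t k ≤ q := by
    intro K
    induction K with
    | zero => exact ⟨1 / 2, by norm_num, le_rfl, by simp⟩
    | succ K ih =>
      obtain ⟨q, h1, h2, h3⟩ := ih
      refine ⟨max q (t K), max_lt h1 (ht1 K), h2.trans (le_max_left _ _), fun k hk => ?_⟩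
      rcases Nat.lt_succ_iff_lt_or_eq.mp hk with h | rfl
      · exact (h3 k h).trans (le_max_left _ _)
      · exact le_max_right _ _
  obtain ⟨q, h1, h2, h3⟩ := this K
  refine ⟨q, h1, by linarith, fun k => ?_⟩
  rcases lt_or_ge k K with h | h
  · exact h3 k h
  · exact (hK k h).trans h2

theorem weightedCount_one_eq_degree (n : Occupation) :
    weightedCount (fun _ => 1) n = ((n.degree : ℕ) : ℝ) := by
  simp [weightedCount, Finsupp.sum, Finsupp.degree_apply]

theorem productWeight_smul (r : ℝ) (t : ℕ → ℝ) (n : Occupation) :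
    productWeight (fun k => r * t k) n = r ^ n.degree * productWeight t n := by
  simp only [productWeight, Finsupp.prod, mul_pow, Finset.prod_mul_distrib, Finset.prod_pow_eq_pow_sum]
  rfl

/-- Quadratic functions of the occupation numbers are summable against a product weight. -/
theorem summable_mul_productWeight {t : ℕ → ℝ} (ht : ∀ k, 0 ≤ t k) (ht1 : ∀ k, t k < 1)
    (hs : Summable t) {G : Occupation → ℝ} {C : ℝ}
    (hG : ∀ n, |G n| ≤ C * (1 + weightedCount (fun _ => 1) n) ^ 2) :
    Summable fun n => G n * productWeight t n := by
  obtain ⟨q, hq1, hq0, hq⟩ := exists_uniform_bound_lt_one ht1 hs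
  -- With `1 < r < 1/q`, the weights `r * t k` are still below 1, and the gained factor `r ^ degree`
  -- dominates any quadratic in the degree.
  obtain ⟨r, hr1, hr2⟩ := exists_between ((one_lt_inv₀ hq0).mpr hq1)
  have hsum : Summable (productWeight fun k => r * t k) := by
    refine summable_productWeight (fun k => mul_nonneg (by linarith) (ht k)) (fun k => ?_)
      (hs.mul_left r)
    calc r * t k ≤ r * q := mul_le_mul_of_nonneg_left (hq k) (by linarith)
      _ < q⁻¹ * q := mul_lt_mul_of_pos_right hr2 hq0
      _ = 1 := inv_mul_cancel₀ hq0.ne'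
  obtain ⟨B, hB⟩ : ∃ B : ℝ, ∀ d : ℕ, (1 + (d : ℝ)) ^ 2 ≤ B * r ^ d := by
    have h0 : Tendsto (fun d : ℕ => (1 + (d : ℝ)) ^ 2 / r ^ d) atTop (𝓝 0) := by
      have h2 := tendsto_pow_const_div_const_pow_of_one_lt 2 hr1
      have h1 := tendsto_pow_const_div_const_pow_of_one_lt 1 hr1
      have h0 := tendsto_pow_const_div_const_pow_of_one_lt 0 hr1
      have := (h0.add (h1.const_mul 2)).add h2
      simp only [mul_zero, add_zero] at this
      refine this.congr fun d => ?_
      ring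
    obtain ⟨B, hB⟩ := h0.bddAbove_range
    refine ⟨B, fun d => ?_⟩
    have := hB ⟨d, rfl⟩
    exact (div_le_iff₀ (pow_pos (by linarith) d)).mp this
  have hC : 0 ≤ C := by
    have h := (abs_nonneg _).trans (hG 0)
    simpa [weightedCount] using h
  refine Summable.of_norm_bounded (hsum.mul_left (C * B)) fun n => ?_
  rw [norm_mul, Real.norm_of_nonneg (productWeight_nonneg ht n), Real.norm_eq_abs,
    productWeight_smul, ← mul_assoc]
  refine mul_le_mul_of_nonneg_right ?_ (productWeight_nonneg ht n)
  refine (hG n).trans ?_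
  rw [weightedCount_one_eq_degree, mul_assoc]
  exact mul_le_mul_of_nonneg_left (hB _) hC

/-- The Palm-type identity `∑ n_k G(n) w(n) = t_k ∑ (n_k + 1) G(n + δ_k) w(n)`. -/
theorem tsum_apply_mul_productWeight (t : ℕ → ℝ) (G : Occupation → ℝ) (k : ℕ) :
    ∑' n, (n k : ℝ) * G n * productWeight t n =
      t k * ∑' n : Occupation,
        ((n k : ℝ) + 1) * G (n + Finsupp.single k 1) * productWeight t n := by
  have hinj : Function.Injective fun n : Occupation => n + Finsupp.single k 1 :=
    add_left_injective _
  -- Occupations with `n k = 0` contribute nothing, so only those of the form `m + δ_k` remain.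
  have hsupp : Function.support (fun n : Occupation => (n k : ℝ) * G n * productWeight t n) ⊆
      Set.range fun n : Occupation => n + Finsupp.single k 1 := by
    intro n hn
    have hk : n k ≠ 0 := fun h => hn (by simp [h])
    exact ⟨n - Finsupp.single k 1,
      tsub_add_cancel_of_le (Finsupp.single_le_iff.mpr (Nat.one_le_iff_ne_zero.mpr hk))⟩
  rw [← hinj.tsum_eq hsupp, ← tsum_mul_left]
  refine tsum_congr fun n => ?_
  rw [productWeight_add_single]
  simp
  ring

/-- Exchange of the sums over modes and over occupations. -/
theorem hasSum_weightedCount_mul {c : ℕ → ℝ} (hc : ∀ k, 0 ≤ c k) {F : Occupation → ℝ}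
    (hF : ∀ n, 0 ≤ F n) (hs : Summable fun n => weightedCount c n * F n) :
    HasSum (fun k => c k * ∑' n : Occupation, (n k : ℝ) * F n)
      (∑' n, weightedCount c n * F n) := by
  have hrow : ∀ n, HasSum (fun k => c k * (n k : ℝ) * F n) (weightedCount c n * F n) := fun n =>
    (hasSum_weightedCount c n).mul_right _
  have hprod : Summable fun p : Occupation × ℕ => c p.2 * (p.1 p.2 : ℝ) * F p.1 := by
    rw [summable_prod_of_nonneg fun p =>
      mul_nonneg (mul_nonneg (hc _) (Nat.cast_nonneg _)) (hF _)]
    refine ⟨fun n => (hrow n).summable, ?_⟩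
    convert hs using 2 with n
    exact (hrow n).tsum_eq
  have h := hprod.prod_symm.prod.hasSum
  have h2 := hprod.tsum_comm (f := fun n k => c k * (n k : ℝ) * F n)
  rw [show (∑' n, weightedCount c n * F n) = ∑' k, ∑' n : Occupation, c k * (n k : ℝ) * F n by
    rw [h2]; exact tsum_congr fun n => (hrow n).tsum_eq.symm]
  have he : (fun k => c k * ∑' n : Occupation, (n k : ℝ) * F n) =
      fun k => ∑' n : Occupation, c k * (n k : ℝ) * F n := funext fun k => by
    rw [← tsum_mul_left]
    exact tsum_congr fun n => (mul_assoc _ _ _).symm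
  rw [he]
  exact h

/-! ### Moments of product weights and of their mean-field perturbations -/

theorem excitedIndicator_nonneg (k : ℕ) : 0 ≤ excitedIndicator k := by
  unfold excitedIndicator; split_ifs <;> norm_num

theorem excitedIndicator_le_one (k : ℕ) : excitedIndicator k ≤ 1 := by
  unfold excitedIndicator; split_ifs <;> norm_num

/-- The number of particles in the positive-energy modes. -/
noncomputable abbrev excitedCount (n : Occupation) : ℝ := weightedCount excitedIndicator n

/-- The total number of particles. -/
noncomputable abbrev totalCount (n : Occupation) : ℝ := weightedCount (fun _ => 1) n

theorem excitedCount_nonneg (n : Occupation) : 0 ≤ excitedCount n :=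
  weightedCount_nonneg excitedIndicator_nonneg n

theorem excitedCount_le_totalCount (n : Occupation) : excitedCount n ≤ totalCount n :=
  weightedCount_mono excitedIndicator_le_one n

theorem totalCount_nonneg (n : Occupation) : 0 ≤ totalCount n :=
  (excitedCount_nonneg n).trans (excitedCount_le_totalCount n)

theorem totalCount_eq (n : Occupation) : totalCount n = (n 0 : ℝ) + n 1 + excitedCount n := by
  have h : (fun _ : ℕ => (1 : ℝ)) = fun k => (if k = 0 ∨ k = 1 then 1 else 0) +
      excitedIndicator k := by
    funext k
    rcases k with _ | _ | k <;> simp [excitedIndicator]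
  rw [totalCount, h, weightedCount_add]
  congr 1
  have h2 := hasSum_weightedCount (fun k : ℕ => if k = 0 ∨ k = 1 then 1 else 0) n
  rw [← h2.tsum_eq, tsum_eq_sum (s := Finset.range 2)]
  · simp [Finset.sum_range_succ]
  · intro k hk
    rw [Finset.mem_range] at hk
    rw [if_neg (by omega), zero_mul]

section moments

variable {t : ℕ → ℝ}

/-- After substituting `G (n + δ_k) = G n + D n`, the sum on the left reappears on the right of the
Palm identity with factor `t k`; solving for it produces the Bose factor `t k / (1 - t k)`. -/
theorem tsum_apply_mul_eq (ht : ∀ k, 0 ≤ t k) (ht1 : ∀ k, t k < 1) (hs : Summable t)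
    {G D : Occupation → ℝ} {C : ℝ} (k : ℕ)
    (hG : ∀ n, |G n| ≤ C * (1 + totalCount n)) (hD : ∀ n, |D n| ≤ C * (1 + totalCount n))
    (hGD : ∀ n, G (n + Finsupp.single k 1) = G n + D n) :
    ∑' n, (n k : ℝ) * G n * productWeight t n =
      t k / (1 - t k) * (∑' n, G n * productWeight t n +
        ∑' n, ((n k : ℝ) + 1) * D n * productWeight t n) := by
  have hC : 0 ≤ C := by
    have h := (abs_nonneg _).trans (hG 0)
    simpa [totalCount, weightedCount] using h
  have h1 : Summable fun n : Occupation => (n k : ℝ) * G n * productWeight t n := by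
    refine summable_mul_productWeight ht ht1 hs (C := C) fun n => ?_
    rw [abs_mul, Nat.abs_cast]
    have := mul_le_mul (apply_le_weightedCount_one n k) (hG n) (abs_nonneg _) (totalCount_nonneg n)
    have h0 := mul_nonneg hC (totalCount_nonneg n)
    nlinarith
  have h2 : Summable fun n => G n * productWeight t n := by
    refine summable_mul_productWeight ht ht1 hs (C := C) fun n => ?_
    refine (hG n).trans (mul_le_mul_of_nonneg_left ?_ hC)
    nlinarith [totalCount_nonneg n]
  have h3 : Summable fun n : Occupation => ((n k : ℝ) + 1) * D n * productWeight t n := by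
    refine summable_mul_productWeight ht ht1 hs (C := C) fun n => ?_
    rw [abs_mul, abs_of_nonneg (by positivity)]
    have := mul_le_mul (add_le_add_left (apply_le_weightedCount_one n k) 1) (hD n) (abs_nonneg _)
      (by linarith [totalCount_nonneg n])
    calc _ ≤ _ := this
      _ = _ := by ring
  have key := tsum_apply_mul_productWeight t G k
  have hsplit : ∑' n : Occupation,
      ((n k : ℝ) + 1) * G (n + Finsupp.single k 1) * productWeight t n =
      ∑' n, (n k : ℝ) * G n * productWeight t n + ∑' n, G n * productWeight t n +
        ∑' n, ((n k : ℝ) + 1) * D n * productWeight t n := by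
    rw [← h1.tsum_add h2, ← (h1.add h2).tsum_add h3]
    refine tsum_congr fun n => ?_
    rw [hGD]
    ring
  rw [hsplit] at key
  have h4 : 1 - t k ≠ 0 := by linarith [ht1 k] |> fun h : 0 < 1 - t k => h.ne'
  rw [div_mul_eq_mul_div, eq_div_iff h4]
  linear_combination key

theorem tsum_apply_mul_of_shift_eq (ht : ∀ k, 0 ≤ t k) (ht1 : ∀ k, t k < 1) (hs : Summable t)
    {G : Occupation → ℝ} (k : ℕ) (hG : ∀ n, |G n| ≤ 1)
    (hGD : ∀ n, G (n + Finsupp.single k 1) = G n) :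
    ∑' n, (n k : ℝ) * G n * productWeight t n =
      t k / (1 - t k) * ∑' n, G n * productWeight t n := by
  have h := tsum_apply_mul_eq ht ht1 hs (G := G) (D := fun _ => 0) (C := 1) k
    (fun n => by linarith [hG n, totalCount_nonneg n])
    (fun n => by simpa using by linarith [totalCount_nonneg n]) (fun n => by simp [hGD])
  simpa using h

/-- Here the increment `D` is nonpositive, so its contribution can be dropped. This is how repulsion
only lowers occupations. -/
theorem tsum_apply_mul_le_of_shift_le (ht : ∀ k, 0 ≤ t k) (ht1 : ∀ k, t k < 1)
    (hs : Summable t) {G : Occupation → ℝ} (k : ℕ) (hG0 : ∀ n, 0 ≤ G n) (hG : ∀ n, G n ≤ 1)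
    (hGD : ∀ n, G (n + Finsupp.single k 1) ≤ G n) :
    ∑' n, (n k : ℝ) * G n * productWeight t n ≤
      t k / (1 - t k) * ∑' n, G n * productWeight t n := by
  rw [tsum_apply_mul_eq ht ht1 hs (G := G) (D := fun n => G (n + Finsupp.single k 1) - G n)
    (C := 1) k (fun n => by rw [abs_of_nonneg (hG0 n)]; linarith [hG n, totalCount_nonneg n])
    (fun n => by
      rw [abs_le]
      constructor <;>
        linarith [hG n, totalCount_nonneg n, hG0 n, hG0 (n + Finsupp.single k 1), hGD n])
    (fun n => by ring)]
  refine mul_le_mul_of_nonneg_left ?_ (div_nonneg (ht k) (by linarith [ht1 k]))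
  have h : ∑' n : Occupation, ((n k : ℝ) + 1) * (G (n + Finsupp.single k 1) - G n) *
      productWeight t n ≤ 0 := by
    refine tsum_nonpos fun n => mul_nonpos_of_nonpos_of_nonneg ?_ (productWeight_nonneg ht n)
    exact mul_nonpos_of_nonneg_of_nonpos (by positivity) (by linarith [hGD n])
  linarith

theorem tsum_productWeight_pos (ht : ∀ k, 0 ≤ t k) (ht1 : ∀ k, t k < 1) (hs : Summable t) :
    0 < ∑' n, productWeight t n := by
  refine lt_of_lt_of_le ?_ ((summable_productWeight ht ht1 hs).le_tsum 0
    fun n _ => productWeight_nonneg ht n)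
  rw [productWeight_zero]
  exact one_pos

theorem tsum_apply_productWeight (ht : ∀ k, 0 ≤ t k) (ht1 : ∀ k, t k < 1) (hs : Summable t)
    (k : ℕ) : ∑' n, (n k : ℝ) * productWeight t n =
      t k / (1 - t k) * ∑' n, productWeight t n := by
  simpa using tsum_apply_mul_of_shift_eq ht ht1 hs (G := fun _ => 1) k (by simp) (by simp)

theorem tsum_excitedCount_productWeight (ht : ∀ k, 0 ≤ t k) (ht1 : ∀ k, t k < 1)
    (hs : Summable t) :
    ∑' n, excitedCount n * productWeight t n =
      (∑' k, excitedIndicator k * (t k / (1 - t k))) * ∑' n, productWeight t n := by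
  have hsum : Summable fun n => excitedCount n * productWeight t n := by
    refine summable_mul_productWeight ht ht1 hs (C := 1) fun n => ?_
    rw [abs_of_nonneg (excitedCount_nonneg n)]
    nlinarith [excitedCount_le_totalCount n, totalCount_nonneg n]
  rw [← (hasSum_weightedCount_mul excitedIndicator_nonneg (productWeight_nonneg ht) hsum).tsum_eq,
    ← tsum_mul_right]
  refine tsum_congr fun k => ?_
  rw [tsum_apply_productWeight ht ht1 hs]
  ring

theorem summable_excitedIndicator_mul {f : ℕ → ℝ} (hf : ∀ k, 0 ≤ f k) (hs : Summable f) :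
    Summable fun k => excitedIndicator k * f k :=
  Summable.of_nonneg_of_le (fun k => mul_nonneg (excitedIndicator_nonneg k) (hf k))
    (fun k => mul_le_of_le_one_left (hf k) (excitedIndicator_le_one k)) hs

/-- Write one factor `Ñ` as `∑ n_k` and apply the Palm identity with `G = Ñ`, which increases by 1
under an excited shift. In expectation `n_k Ñ` gives `b_k (1 + b_k + M)`; the bound `b_k ≤ B` makes
the variance linear in the mean `M`. -/
theorem tsum_excitedCount_sq_le (ht : ∀ k, 0 ≤ t k) (ht1 : ∀ k, t k < 1) (hs : Summable t)
    {B : ℝ} (hB : ∀ k, 2 ≤ k → t k / (1 - t k) ≤ B) :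
    ∑' n, excitedCount n ^ 2 * productWeight t n ≤
      ((∑' k, excitedIndicator k * (t k / (1 - t k))) * (1 + B) +
        (∑' k, excitedIndicator k * (t k / (1 - t k))) ^ 2) * ∑' n, productWeight t n := by
  set b : ℕ → ℝ := fun k => t k / (1 - t k) with hb
  set M := ∑' k, excitedIndicator k * b k with hM
  set Z := ∑' n, productWeight t n with hZ
  have hZ0 : 0 < Z := tsum_productWeight_pos ht ht1 hs
  have hb0 : ∀ k, 0 ≤ b k := fun k => div_nonneg (ht k) (by linarith [ht1 k])
  have hbs : Summable fun k => excitedIndicator k * b k :=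
    summable_excitedIndicator_mul hb0 (summable_div_one_sub ht hs)
  have hsum : Summable fun n => excitedCount n * (excitedCount n * productWeight t n) := by
    have : Summable fun n => excitedCount n ^ 2 * productWeight t n := by
      refine summable_mul_productWeight ht ht1 hs (C := 1) fun n => ?_
      rw [abs_of_nonneg (sq_nonneg _), one_mul]
      exact pow_le_pow_left₀ (excitedCount_nonneg n)
        (by linarith [excitedCount_le_totalCount n]) 2
    refine this.congr fun n => ?_
    ring
  have hswap := hasSum_weightedCount_mul excitedIndicator_nonneg
    (fun n => mul_nonneg (excitedCount_nonneg n) (productWeight_nonneg ht n)) hsum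
  have hterm : ∀ k, excitedIndicator k * ∑' n : Occupation,
      (n k : ℝ) * (excitedCount n * productWeight t n) ≤
        excitedIndicator k * b k * ((1 + B + M) * Z) := by
    intro k
    by_cases hk : 2 ≤ k
    · have h1 := tsum_apply_mul_eq ht ht1 hs (G := excitedCount) (D := fun _ => 1) (C := 1) k
        (fun n => by
          rw [abs_of_nonneg (excitedCount_nonneg n)]; linarith [excitedCount_le_totalCount n])
        (fun n => by simpa using totalCount_nonneg n)
        (fun n => by simp [excitedCount, weightedCount_add_single, excitedIndicator, hk])
      have h2 : ∑' n : Occupation, ((n k : ℝ) + 1) * 1 * productWeight t n = b k * Z + Z := by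
        rw [← tsum_apply_productWeight ht ht1 hs k, hZ, ← Summable.tsum_add]
        · exact tsum_congr fun n => by ring
        · refine summable_mul_productWeight ht ht1 hs (C := 1) fun n => ?_
          rw [Nat.abs_cast]
          nlinarith [apply_le_weightedCount_one n k, totalCount_nonneg n]
        · exact summable_productWeight ht ht1 hs
      rw [h2, tsum_excitedCount_productWeight ht ht1 hs] at h1
      rw [mul_assoc]
      refine mul_le_mul_of_nonneg_left ?_ (excitedIndicator_nonneg k)
      calc ∑' n : Occupation, (n k : ℝ) * (excitedCount n * productWeight t n)
          = b k * (M * Z + (b k * Z + Z)) := by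
            rw [← h1]
            exact tsum_congr fun n => (mul_assoc _ _ _).symm
        _ = b k * ((1 + b k + M) * Z) := by ring
        _ ≤ _ := by
          have := hB k hk
          have h3 := hb0 k
          gcongr
    · simp [excitedIndicator, hk]
  calc ∑' n, excitedCount n ^ 2 * productWeight t n
      = ∑' n, excitedCount n * (excitedCount n * productWeight t n) :=
        tsum_congr fun n => by ring
    _ ≤ ∑' k, excitedIndicator k * b k * ((1 + B + M) * Z) := by
        rw [← hswap.tsum_eq]
        exact hswap.summable.tsum_le_tsum hterm (hbs.mul_right _)
    _ = _ := by rw [tsum_mul_right]; ring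

/-- A Gaussian tilt of width of the order of the standard deviation moves the mean of `Y` by at
most a multiple of the standard deviation. -/
theorem abs_tsum_mul_exp_neg_sq_le {ι : Type*} {v Y : ι → ℝ} (hv : ∀ i, 0 ≤ v i)
    (hvs : Summable v) (hY : Summable fun i => Y i ^ 2 * v i) {c V : ℝ} (hc : 0 ≤ c) (hV : 0 < V)
    (hle : ∑' i, Y i ^ 2 * v i ≤ V * ∑' i, v i) :
    |∑' i, Y i * Real.exp (-c * Y i ^ 2) * v i| ≤
      Real.sqrt V * Real.exp (c * V) * ∑' i, Real.exp (-c * Y i ^ 2) * v i := by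
  set Z := ∑' i, v i with hZ
  have hs0 : 0 < Real.sqrt V := Real.sqrt_pos.mpr hV
  have hsq : Real.sqrt V ^ 2 = V := Real.sq_sqrt hV.le
  have hexp1 : ∀ i, Real.exp (-c * Y i ^ 2) ≤ 1 := fun i =>
    Real.exp_le_one_iff.mpr (by nlinarith [mul_nonneg hc (sq_nonneg (Y i))])
  have hsumE : Summable fun i => Real.exp (-c * Y i ^ 2) * v i :=
    Summable.of_nonneg_of_le (fun i => mul_nonneg (Real.exp_pos _).le (hv i))
      (fun i => mul_le_of_le_one_left (hv i) (hexp1 i)) hvs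
  -- Arithmetic-geometric mean: `|Y| ≤ (Y² / √V + √V) / 2`, balanced so that both terms sum to at
  -- most `√V Z`.
  have hpt : ∀ i, |Y i * Real.exp (-c * Y i ^ 2) * v i| ≤
      (Y i ^ 2 * v i / Real.sqrt V + Real.sqrt V * v i) / 2 := by
    intro i
    rw [abs_mul, abs_mul, Real.abs_exp, abs_of_nonneg (hv i)]
    calc |Y i| * Real.exp (-c * Y i ^ 2) * v i ≤ |Y i| * v i :=
          mul_le_mul_of_nonneg_right (mul_le_of_le_one_right (abs_nonneg _) (hexp1 i)) (hv i)
      _ ≤ ((Y i ^ 2 / Real.sqrt V + Real.sqrt V) / 2) * v i := by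
          refine mul_le_mul_of_nonneg_right ?_ (hv i)
          rw [le_div_iff₀ two_pos, div_add' _ _ _ hs0.ne', le_div_iff₀ hs0, ← sq_abs (Y i)]
          nlinarith [sq_nonneg (|Y i| - Real.sqrt V)]
      _ = _ := by ring
  have hbs : Summable fun i => (Y i ^ 2 * v i / Real.sqrt V + Real.sqrt V * v i) / 2 :=
    ((hY.div_const _).add (hvs.mul_left _)).div_const _
  have hnum : |∑' i, Y i * Real.exp (-c * Y i ^ 2) * v i| ≤ Real.sqrt V * Z := by
    have h1 := tsum_of_norm_bounded (f := fun i => Y i * Real.exp (-c * Y i ^ 2) * v i)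
      hbs.hasSum hpt
    rw [Real.norm_eq_abs] at h1
    refine h1.trans ?_
    rw [tsum_div_const, Summable.tsum_add (hY.div_const _) (hvs.mul_left _), tsum_div_const,
      tsum_mul_left, ← hZ]
    have h2 : (∑' i, Y i ^ 2 * v i) / Real.sqrt V ≤ Real.sqrt V * Z := by
      rw [div_le_iff₀ hs0]
      calc _ ≤ V * Z := hle
        _ = _ := by linear_combination -Z * hsq
    linarith
  -- The tilt cannot destroy too much mass: `exp (cV - cY²) ≥ 1 + cV - cY²`, and the sum of the
  -- right side against `v` is at least `Z` by the second-moment bound.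
  have hden : Z ≤ Real.exp (c * V) * ∑' i, Real.exp (-c * Y i ^ 2) * v i := by
    have hs1 : Summable fun i => (1 + c * V) * v i - c * (Y i ^ 2 * v i) :=
      (hvs.mul_left _).sub (hY.mul_left _)
    have h1 : ∑' i, ((1 + c * V) * v i - c * (Y i ^ 2 * v i)) ≤
        ∑' i, Real.exp (c * V) * (Real.exp (-c * Y i ^ 2) * v i) := by
      refine hs1.tsum_le_tsum (fun i => ?_) (hsumE.mul_left _)
      rw [← mul_assoc (Real.exp _), ← Real.exp_add]
      have h2 := Real.add_one_le_exp (c * V + -c * Y i ^ 2)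
      nlinarith [mul_le_mul_of_nonneg_right h2 (hv i)]
    rw [Summable.tsum_sub (hvs.mul_left _) (hY.mul_left _), tsum_mul_left, tsum_mul_left,
      tsum_mul_left, ← hZ] at h1
    nlinarith [mul_le_mul_of_nonneg_left hle hc]
  calc _ ≤ Real.sqrt V * Z := hnum
    _ ≤ Real.sqrt V * (Real.exp (c * V) * ∑' i, Real.exp (-c * Y i ^ 2) * v i) :=
        mul_le_mul_of_nonneg_left hden hs0.le
    _ = _ := by ring

end moments

/-! ### The one-particle spectrum -/

/-- A function with zero derivative within a compact interval is constant there. -/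
theorem eq_of_hasDerivWithinAt_zero {f : ℝ → ℝ} {a b : ℝ}
    (hf : ∀ x ∈ Set.Icc a b, HasDerivWithinAt f 0 (Set.Icc a b) x) :
    ∀ x ∈ Set.Icc a b, f x = f a :=
  constant_of_derivWithin_zero (fun x hx => (hf x hx).differentiableWithinAt) fun x hx =>
    (hf x (Set.Ico_subset_Icc_self hx)).derivWithin
      (uniqueDiffOn_Icc (hx.1.trans_lt hx.2) x (Set.Ico_subset_Icc_self hx))

/-- The eigenvalue condition in terms of an even solution `C` and an odd solution `S` of
`φ'' = -e φ`. -/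
theorem isEnergyLevel_iff {σ L e : ℝ} (hL : 0 < L) {C S : ℝ → ℝ}
    (hC : ∀ x, HasDerivAt C (-(e * S x)) x) (hS : ∀ x, HasDerivAt S (C x) x)
    (hCe : ∀ x, C (-x) = C x) (hSo : ∀ x, S (-x) = -S x)
    (hCS : ∀ x, C x ^ 2 + e * S x ^ 2 = 1) :
    IsEnergyLevel σ L e ↔
      C (L / 2) + σ * S (L / 2) = 0 ∨ e * S (L / 2) - σ * C (L / 2) = 0 := by
  have hab : -(L / 2) ≤ L / 2 := by linarith
  have hmemr : L / 2 ∈ Set.Icc (-(L / 2)) (L / 2) := ⟨hab, le_rfl⟩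
  constructor
  · rintro ⟨φ, φ', h1, h2, h3, h4, x0, hx0, hne⟩
    -- `hA` and `hB` are two conserved Wronskian-type quantities. As `C² + e S² = 1`, they can be
    -- inverted to express any solution through `S` and `C`.
    have hA := eq_of_hasDerivWithinAt_zero (f := fun x => φ' x * C x + e * (φ x * S x))
      (fun x hx => by
        have := ((h2 x hx).mul (hC x).hasDerivWithinAt).add
          (((h1 x hx).mul (hS x).hasDerivWithinAt).const_mul e)
        exact this.congr_deriv (by ring))
    have hB := eq_of_hasDerivWithinAt_zero (f := fun x => φ' x * S x - φ x * C x)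
      (fun x hx => by
        have := ((h2 x hx).mul (hS x).hasDerivWithinAt).sub
          ((h1 x hx).mul (hC x).hasDerivWithinAt)
        exact this.congr_deriv (by ring))
    set a := φ' (-(L / 2)) * C (-(L / 2)) + e * (φ (-(L / 2)) * S (-(L / 2))) with ha
    set b := φ' (-(L / 2)) * S (-(L / 2)) - φ (-(L / 2)) * C (-(L / 2)) with hb
    have hφ : ∀ x ∈ Set.Icc (-(L / 2)) (L / 2), φ x = a * S x - b * C x := fun x hx => by
      linear_combination S x * hA x hx - C x * hB x hx - φ x * hCS x
    have hφ' : ∀ x ∈ Set.Icc (-(L / 2)) (L / 2), φ' x = a * C x + e * b * S x := fun x hx => by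
      linear_combination C x * hA x hx + e * S x * hB x hx - φ' x * hCS x
    have hl : -(L / 2) ∈ Set.Icc (-(L / 2)) (L / 2) := ⟨le_rfl, hab⟩
    have e1 := hφ _ hl
    have e2 := hφ' _ hl
    rw [hSo, hCe] at e1 e2
    rw [e1, e2] at h3
    rw [hφ _ hmemr, hφ' _ hmemr] at h4
    -- The sum and the difference of the two boundary conditions separate the odd part (coefficient
    -- `a`) from the even part (coefficient `b`).
    have k1 : a * (C (L / 2) + σ * S (L / 2)) = 0 := by linear_combination (h3 + h4) / 2
    have k2 : b * (e * S (L / 2) - σ * C (L / 2)) = 0 := by linear_combination (h4 - h3) / 2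
    rcases mul_eq_zero.mp k1 with ha0 | h
    · rcases mul_eq_zero.mp k2 with hb0 | h
      · exact absurd (by rw [hφ x0 hx0, ha0, hb0]; ring) hne
      · exact Or.inr h
    · exact Or.inl h
  · have hne : ∀ x, C x = 0 → S x = 0 → False := fun x h h' => by
      have := hCS x
      rw [h, h'] at this
      norm_num at this
    have hC0 : ∃ x ∈ Set.Icc (-(L / 2)) (L / 2), C x ≠ 0 := by
      refine ⟨0, ⟨by linarith, by linarith⟩, fun h => hne 0 h ?_⟩
      have := hSo 0
      rw [neg_zero] at this
      linarith
    rintro (h | h)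
    · refine ⟨S, C, fun x _ => (hS x).hasDerivWithinAt, fun x _ => (hC x).hasDerivWithinAt, ?_, h,
        ?_⟩
      · rw [hSo, hCe]
        linarith
      · by_contra! h0
        exact hne _ (by simpa [h0 _ hmemr] using h) (h0 _ hmemr)
    · refine ⟨C, fun x => -(e * S x), fun x _ => (hC x).hasDerivWithinAt, fun x _ => ?_, ?_, ?_,
        hC0⟩
      · exact ((hS x).const_mul e).neg.hasDerivWithinAt
      · change -(e * S (-(L / 2))) - σ * C (-(L / 2)) = 0
        rw [hSo, hCe]
        linarith
      · linarith

theorem isEnergyLevel_zero_iff {σ L : ℝ} (hσ : σ < 0) (hL : 0 < L) :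
    IsEnergyLevel σ L 0 ↔ L * |σ| = 2 := by
  rw [isEnergyLevel_iff hL (C := fun _ => 1) (S := fun x => x)
    (fun x => by simpa using hasDerivAt_const x (1 : ℝ)) (fun x => hasDerivAt_id x)
    (fun _ => rfl) (fun _ => rfl) (fun x => by ring), abs_of_neg hσ]
  constructor
  · rintro (h | h) <;> linarith
  · intro h
    left
    linarith

theorem isEnergyLevel_neg_sq_iff {σ L κ : ℝ} (hL : 0 < L) (hκ : 0 < κ) :
    IsEnergyLevel σ L (-κ ^ 2) ↔
      κ * Real.cosh (κ * (L / 2)) = -σ * Real.sinh (κ * (L / 2)) ∨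
        κ * Real.sinh (κ * (L / 2)) = -σ * Real.cosh (κ * (L / 2)) := by
  have hlin : ∀ x : ℝ, HasDerivAt (fun y => κ * y) κ x := fun x => by
    simpa using (hasDerivAt_id x).const_mul κ
  rw [isEnergyLevel_iff hL (C := fun x => Real.cosh (κ * x)) (S := fun x => Real.sinh (κ * x) / κ)
    (fun x => by
      exact (hlin x).cosh.congr_deriv (by field_simp))
    (fun x => by
      exact ((hlin x).sinh.div_const κ).congr_deriv (by field_simp))
    (fun x => by rw [mul_neg, Real.cosh_neg]) (fun x => by rw [mul_neg, Real.sinh_neg]; ring)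
    (fun x => by
      have := Real.cosh_sq (κ * x)
      field_simp
      linarith)]
  refine or_congr ?_ ?_
  · field_simp
    constructor <;> intro h <;> linarith
  · field_simp
    constructor <;> intro h <;> linarith

theorem isEnergyLevel_sq_iff {σ L κ : ℝ} (hL : 0 < L) (hκ : 0 < κ) :
    IsEnergyLevel σ L (κ ^ 2) ↔
      κ * Real.cos (κ * (L / 2)) + σ * Real.sin (κ * (L / 2)) = 0 ∨
        κ * Real.sin (κ * (L / 2)) - σ * Real.cos (κ * (L / 2)) = 0 := by
  have hlin : ∀ x : ℝ, HasDerivAt (fun y => κ * y) κ x := fun x => by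
    simpa using (hasDerivAt_id x).const_mul κ
  rw [isEnergyLevel_iff hL (C := fun x => Real.cos (κ * x)) (S := fun x => Real.sin (κ * x) / κ)
    (fun x => by
      exact (hlin x).cos.congr_deriv (by field_simp))
    (fun x => by
      exact ((hlin x).sin.div_const κ).congr_deriv (by field_simp))
    (fun x => by rw [mul_neg, Real.cos_neg]) (fun x => by rw [mul_neg, Real.sin_neg]; ring)
    (fun x => by
      have := Real.cos_sq_add_sin_sq (κ * x)
      field_simp
      linarith)]
  refine or_congr ?_ ?_
  · field_simp
    rw [mul_zero]
  · field_simp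

/-! #### Positive levels -/

/-- The phase `θ + arctan (a / θ)`; the positive levels are those `(2 θ / L)²` at which it is a
multiple of `π / 2`. -/
noncomputable def levelPhase (a θ : ℝ) : ℝ := θ + Real.arctan (a / θ)

theorem hasDerivAt_levelPhase (a : ℝ) {θ : ℝ} (hθ : 0 < θ) :
    HasDerivAt (levelPhase a) (1 - a / (θ ^ 2 + a ^ 2)) θ := by
  have h := (hasDerivAt_id θ).add (((hasDerivAt_const θ a).div (hasDerivAt_id θ) hθ.ne').arctan)
  refine h.congr_deriv ?_
  simp only [id, Pi.div_apply]
  field_simp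
  ring

/-- The derivative `1 - a / (θ² + a²)` is positive because `a < a²`; with `a = |σ| L / 2`, the
condition `a > 1` is exactly `L |σ| > 2`. -/
theorem strictMonoOn_levelPhase {a : ℝ} (ha : 1 < a) :
    StrictMonoOn (levelPhase a) (Set.Ioi 0) := by
  refine strictMonoOn_of_deriv_pos (convex_Ioi 0)
    (fun θ hθ => (hasDerivAt_levelPhase a hθ).continuousAt.continuousWithinAt) fun θ hθ => ?_
  rw [interior_Ioi] at hθ
  rw [(hasDerivAt_levelPhase a hθ).deriv, sub_pos, div_lt_one (by positivity)]
  nlinarith [sq_nonneg θ, Set.mem_Ioi.mp hθ]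

theorem lt_levelPhase {a θ : ℝ} (ha : 0 < a) (hθ : 0 < θ) : θ < levelPhase a θ :=
  lt_add_of_pos_right _ (Real.arctan_pos.mpr (div_pos ha hθ))

theorem levelPhase_lt (a θ : ℝ) : levelPhase a θ < θ + Real.pi / 2 :=
  add_lt_add_right (Real.arctan_lt_pi_div_two _) θ

/-- The phase increases strictly from its limit `π / 2` at `0+`. Hence the multiples 0 and 1 of `π /
2` are never attained: these two missing positive levels are the negative ones. -/
theorem pi_div_two_lt_levelPhase {a θ : ℝ} (ha : 1 < a) (hθ : 0 < θ) :
    Real.pi / 2 < levelPhase a θ := by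
  by_contra! h
  have hlim : Tendsto (levelPhase a) (𝓝[>] 0) (𝓝 (0 + Real.pi / 2)) := by
    refine (tendsto_nhdsWithin_of_tendsto_nhds tendsto_id).add ?_
    have h1 : Tendsto (fun θ : ℝ => a / θ) (𝓝[>] 0) atTop := by
      simpa [div_eq_mul_inv] using tendsto_inv_nhdsGT_zero.const_mul_atTop (by linarith : 0 < a)
    exact (tendsto_nhds_of_tendsto_nhdsWithin Real.tendsto_arctan_atTop).comp h1
  rw [zero_add] at hlim
  have h2 : levelPhase a (θ / 2) < levelPhase a θ :=
    strictMonoOn_levelPhase ha (half_pos hθ) hθ (half_lt_self hθ)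
  have h3 : Real.pi / 2 ≤ levelPhase a (θ / 2) := by
    refine le_of_tendsto hlim ?_
    filter_upwards [Ioo_mem_nhdsGT (half_pos hθ)] with x hx
    exact (strictMonoOn_levelPhase ha hx.1 (half_pos hθ) hx.2).le
  linarith

theorem exists_levelPhase_eq {a : ℝ} (ha : 1 < a) (j : ℕ) :
    ∃ θ, 0 < θ ∧ levelPhase a θ = ((j : ℝ) + 2) * Real.pi / 2 := by
  have hpi := Real.pi_pos
  have hj : (0 : ℝ) ≤ j := Nat.cast_nonneg j
  have h0 : 0 < ((j : ℝ) + 1) * Real.pi / 2 := by positivity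
  have hle : ((j : ℝ) + 1) * Real.pi / 2 ≤ ((j : ℝ) + 2) * Real.pi / 2 := by nlinarith
  have hcont : ContinuousOn (levelPhase a)
      (Set.Icc (((j : ℝ) + 1) * Real.pi / 2) (((j : ℝ) + 2) * Real.pi / 2)) := fun θ hθ =>
    (hasDerivAt_levelPhase a (h0.trans_le hθ.1)).continuousAt.continuousWithinAt
  obtain ⟨θ, hθ, h⟩ := intermediate_value_Icc hle hcont
    ⟨by linarith [levelPhase_lt a (((j : ℝ) + 1) * Real.pi / 2)],
      (lt_levelPhase (by linarith) (h0.trans_le hle)).le⟩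
  exact ⟨θ, h0.trans_le hθ.1, h⟩

/-- With `tan α = |σ| / κ`, the two parity conditions become `cos (θ + α) = 0` and `sin (θ + α) =
0`, jointly `sin (2 (θ + α)) = 0`. The lower bound on the phase leaves the multiples `m ≥ 2`. -/
theorem isEnergyLevel_sq_iff_levelPhase {σ L κ : ℝ} (hσ : σ < 0) (hL : 2 < L * |σ|) (hL0 : 0 < L)
    (hκ : 0 < κ) :
    IsEnergyLevel σ L (κ ^ 2) ↔
      ∃ j : ℕ, levelPhase (|σ| * (L / 2)) (κ * (L / 2)) = ((j : ℝ) + 2) * Real.pi / 2 := by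
  have hpi := Real.pi_pos
  rw [isEnergyLevel_sq_iff hL0 hκ]
  set θ := κ * (L / 2) with hθ
  set a := |σ| * (L / 2) with ha
  have hθ0 : 0 < θ := by positivity
  have ha1 : 1 < a := by rw [ha]; linarith
  set α := Real.arctan (a / θ) with hα
  have hcosα : 0 < Real.cos α := Real.cos_arctan_pos _
  have htan : Real.sin α * κ = -σ * Real.cos α := by
    have h1 : Real.tan α = a / θ := Real.tan_arctan _
    rw [Real.tan_eq_sin_div_cos, div_eq_div_iff hcosα.ne' hθ0.ne', hθ, ha, abs_of_neg hσ] at h1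
    have h2 : (L / 2) * (Real.sin α * κ) = (L / 2) * (-σ * Real.cos α) := by
      linear_combination h1
    exact mul_left_cancel₀ (by positivity) h2
  have h1 : κ * Real.cos θ + σ * Real.sin θ = 0 ↔ Real.cos (θ + α) = 0 := by
    have : Real.cos α * (κ * Real.cos θ + σ * Real.sin θ) = κ * Real.cos (θ + α) := by
      rw [Real.cos_add]
      linear_combination Real.sin θ * htan
    constructor
    · intro h
      rw [h, mul_zero] at this
      exact (mul_eq_zero.mp this.symm).resolve_left hκ.ne'
    · intro h
      rw [h, mul_zero] at this
      exact (mul_eq_zero.mp this).resolve_left hcosα.ne'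
  have h2 : κ * Real.sin θ - σ * Real.cos θ = 0 ↔ Real.sin (θ + α) = 0 := by
    have : Real.cos α * (κ * Real.sin θ - σ * Real.cos θ) = κ * Real.sin (θ + α) := by
      rw [Real.sin_add]
      linear_combination -Real.cos θ * htan
    constructor
    · intro h
      rw [h, mul_zero] at this
      exact (mul_eq_zero.mp this.symm).resolve_left hκ.ne'
    · intro h
      rw [h, mul_zero] at this
      exact (mul_eq_zero.mp this).resolve_left hcosα.ne'
  have hG : levelPhase a θ = θ + α := rfl
  have hlow := pi_div_two_lt_levelPhase ha1 hθ0
  rw [h1, h2, hG]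
  rw [hG] at hlow
  have h3 : (Real.cos (θ + α) = 0 ∨ Real.sin (θ + α) = 0) ↔ Real.sin (2 * (θ + α)) = 0 := by
    rw [Real.sin_two_mul, mul_eq_zero, mul_eq_zero]
    constructor
    · rintro (h | h)
      · exact Or.inr h
      · exact Or.inl (Or.inr h)
    · rintro ((h | h) | h)
      · norm_num at h
      · exact Or.inr h
      · exact Or.inl h
  rw [h3, Real.sin_eq_zero_iff]
  constructor
  · rintro ⟨m, hm⟩
    have hm1 : 1 < m := by
      have : (1 : ℝ) < m := by
        by_contra! h
        nlinarith
      exact_mod_cast this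
    obtain ⟨j, hj⟩ := Int.eq_ofNat_of_zero_le (show 0 ≤ m - 2 by omega)
    refine ⟨j, ?_⟩
    have : (m : ℝ) = (j : ℝ) + 2 := by
      have : m = (j : ℤ) + 2 := by omega
      rw [this]
      push_cast
      ring
    rw [← this]
    linarith
  · rintro ⟨j, hj⟩
    refine ⟨(j : ℤ) + 2, ?_⟩
    rw [hj]
    push_cast
    ring

/-! #### Negative levels -/

theorem tanh_strictMono : StrictMono Real.tanh := by
  intro x y h
  rw [Real.tanh_eq_sinh_div_cosh, Real.tanh_eq_sinh_div_cosh,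
    div_lt_div_iff₀ (Real.cosh_pos x) (Real.cosh_pos y)]
  have := Real.sinh_pos_iff.mpr (sub_pos.mpr h)
  rw [Real.sinh_sub] at this
  linarith

theorem tanh_pos {x : ℝ} (hx : 0 < x) : 0 < Real.tanh x := by
  simpa using tanh_strictMono hx

theorem continuous_tanh : Continuous Real.tanh := by
  rw [funext Real.tanh_eq_sinh_div_cosh]
  exact Real.continuous_sinh.div Real.continuous_cosh fun x => (Real.cosh_pos x).ne'

theorem tendsto_tanh_atTop : Tendsto Real.tanh atTop (𝓝 1) := by
  have h : ∀ x : ℝ, Real.tanh x = (1 - Real.exp (-(2 * x))) / (1 + Real.exp (-(2 * x))) := by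
    intro x
    have h2 : Real.exp (-(2 * x)) = Real.exp (-x) * Real.exp (-x) := by
      rw [← Real.exp_add]; ring_nf
    have h3 : Real.exp x * Real.exp (-x) = 1 := by rw [← Real.exp_add]; simp
    have hx := Real.exp_pos x
    have hx' := Real.exp_pos (-x)
    rw [Real.tanh_eq, h2, div_eq_div_iff (by positivity) (by positivity)]
    linear_combination (2 * Real.exp (-x)) * h3
  have h0 : Tendsto (fun x : ℝ => Real.exp (-(2 * x))) atTop (𝓝 0) :=
    Real.tendsto_exp_neg_atTop_nhds_zero.comp (tendsto_id.const_mul_atTop two_pos)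
  rw [funext h]
  have h1 := ((tendsto_const_nhds (x := (1 : ℝ))).sub h0).div (tendsto_const_nhds.add h0)
    (show (1 : ℝ) + 0 ≠ 0 by norm_num)
  simp only [sub_zero, add_zero, div_one] at h1
  exact h1

/-- The equation is `κ tanh (κ l) = s`, with strictly increasing left side. It is solved between `s`
and `s / tanh (s l)`; the upper end later squeezes the ground energy to `-σ²`. -/
theorem exists_even_level {s l : ℝ} (hs : 0 < s) (hl : 0 < l) :
    ∃ κ₀, s < κ₀ ∧ κ₀ * Real.tanh (s * l) ≤ s ∧
      ∀ κ, 0 < κ → (κ * Real.sinh (κ * l) = s * Real.cosh (κ * l) ↔ κ = κ₀) := by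
  have hT := tanh_pos (mul_pos hs hl)
  have hT1 := Real.tanh_lt_one (s * l)
  have hiff : ∀ κ, κ * Real.sinh (κ * l) = s * Real.cosh (κ * l) ↔ κ * Real.tanh (κ * l) = s := by
    intro κ
    rw [Real.tanh_eq_sinh_div_cosh, mul_div_assoc', div_eq_iff (Real.cosh_pos _).ne']
  have hmono : ∀ x y, 0 < x → x < y → x * Real.tanh (x * l) < y * Real.tanh (y * l) :=
    fun x y hx hxy => mul_lt_mul'' hxy (tanh_strictMono (mul_lt_mul_of_pos_right hxy hl)) hx.le
      (tanh_pos (mul_pos hx hl)).le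
  have hsb : s < s / Real.tanh (s * l) := by
    rw [lt_div_iff₀ hT]
    nlinarith
  have hcont : Continuous fun κ => κ * Real.tanh (κ * l) :=
    continuous_id.mul (continuous_tanh.comp (continuous_id.mul continuous_const))
  obtain ⟨κ₀, hκ, h⟩ := intermediate_value_Icc hsb.le hcont.continuousOn
    (show s ∈ Set.Icc _ _ from ⟨by nlinarith, by
      calc s = s / Real.tanh (s * l) * Real.tanh (s * l) := by field_simp
        _ ≤ _ := by
          have h1 := tanh_strictMono (mul_lt_mul_of_pos_right hsb hl)
          exact mul_le_mul_of_nonneg_left h1.le (hs.trans hsb).le⟩)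
  simp only at h
  have hκs : s < κ₀ := by
    rcases hκ.1.eq_or_lt with h1 | h1
    · rw [← h1] at h
      nlinarith
    · exact h1
  refine ⟨κ₀, hκs, (le_div_iff₀ hT).mp hκ.2, fun κ hκ0 => ?_⟩
  rw [hiff]
  constructor
  · intro h1
    rcases lt_trichotomy κ κ₀ with h2 | h2 | h2
    · linarith [hmono _ _ hκ0 h2]
    · exact h2
    · linarith [hmono _ _ (hs.trans hκs) h2]
  · rintro rfl
    exact h

/-- By `cosh² - sinh² = 1` the numerator of the derivative is `sinh θ cosh θ - θ`, positive since
`sinh θ > θ` and `cosh θ ≥ 1`. -/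
theorem strictMonoOn_mul_coth :
    StrictMonoOn (fun θ => θ * Real.cosh θ / Real.sinh θ) (Set.Ioi 0) := by
  have hd : ∀ θ : ℝ, 0 < θ → HasDerivAt (fun θ => θ * Real.cosh θ / Real.sinh θ)
      (((1 * Real.cosh θ + θ * Real.sinh θ) * Real.sinh θ - θ * Real.cosh θ * Real.cosh θ) /
        Real.sinh θ ^ 2) θ := fun θ hθ =>
    ((hasDerivAt_id θ).mul (Real.hasDerivAt_cosh θ)).div (Real.hasDerivAt_sinh θ)
      (Real.sinh_pos_iff.mpr hθ).ne'
  refine strictMonoOn_of_deriv_pos (convex_Ioi 0)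
    (fun θ hθ => (hd θ hθ).continuousAt.continuousWithinAt) fun θ hθ => ?_
  rw [interior_Ioi] at hθ
  have hθ0 : 0 < θ := hθ
  rw [(hd θ hθ).deriv]
  have h1 : θ < Real.sinh θ := Real.self_lt_sinh_iff.mpr hθ0
  have h2 := Real.one_le_cosh θ
  have h3 := Real.cosh_sq θ
  refine div_pos ?_ (by positivity)
  nlinarith

/-- The equation reads `θ coth θ = s l` for `θ = κ l`. As `θ coth θ` rises from its limit 1 at zero,
a solution needs `s l > 1`. -/
theorem exists_odd_level {s l : ℝ} (hs : 0 < s) (hl : 0 < l) (hsl : 1 < s * l) :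
    ∃ κ₁, 0 < κ₁ ∧ κ₁ < s ∧
      ∀ κ, 0 < κ → (κ * Real.cosh (κ * l) = s * Real.sinh (κ * l) ↔ κ = κ₁) := by
  -- Near zero `cosh (ε l) < s l`, so `ε cosh (ε l) ≤ s (ε l) ≤ s sinh (ε l)`: the left sign needed
  -- for the intermediate value theorem, away from the trivial root 0.
  obtain ⟨ε, hε, hεs, hεc⟩ : ∃ ε, 0 < ε ∧ ε < s ∧ Real.cosh (ε * l) < s * l := by
    have hcont : Continuous fun x => Real.cosh (x * l) := by fun_prop
    have h1 : ∀ᶠ x in 𝓝[>] (0 : ℝ), Real.cosh (x * l) < s * l :=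
      (hcont.continuousAt.tendsto.mono_left nhdsWithin_le_nhds).eventually_lt_const
        (by simpa using hsl)
    obtain ⟨ε, h2, h3⟩ := (h1.and (Ioo_mem_nhdsGT hs)).exists
    exact ⟨ε, h3.1, h3.2, h2⟩
  have hcont : Continuous fun κ => κ * Real.cosh (κ * l) - s * Real.sinh (κ * l) := by fun_prop
  have hleft : ε * Real.cosh (ε * l) - s * Real.sinh (ε * l) ≤ 0 := by
    have h1 := Real.self_le_sinh_iff.mpr (mul_pos hε hl).le
    nlinarith
  have hright : 0 < s * Real.cosh (s * l) - s * Real.sinh (s * l) := by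
    have := Real.sinh_lt_cosh (s * l)
    nlinarith
  obtain ⟨κ₁, hκ, h⟩ := intermediate_value_Icc hεs.le hcont.continuousOn
    (show (0 : ℝ) ∈ Set.Icc _ _ from ⟨hleft, hright.le⟩)
  simp only at h
  have hκ0 : 0 < κ₁ := hε.trans_le hκ.1
  have hiff : ∀ κ, 0 < κ → (κ * Real.cosh (κ * l) = s * Real.sinh (κ * l) ↔
      κ * l * Real.cosh (κ * l) / Real.sinh (κ * l) = s * l) := by
    intro κ hκ
    rw [div_eq_iff (Real.sinh_pos_iff.mpr (mul_pos hκ hl)).ne']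
    constructor
    · intro h
      linear_combination l * h
    · intro h
      refine mul_left_cancel₀ hl.ne' ?_
      linear_combination h
  refine ⟨κ₁, hκ0, hκ.2.lt_of_ne fun h1 => ?_, fun κ hκ2 => ?_⟩
  · rw [h1] at h
    linarith
  · constructor
    · intro h1
      have h2 : κ₁ * Real.cosh (κ₁ * l) = s * Real.sinh (κ₁ * l) := by linarith
      rw [hiff κ hκ2] at h1
      rw [hiff κ₁ hκ0] at h2
      exact mul_right_cancel₀ hl.ne' (strictMonoOn_mul_coth.injOn (mul_pos hκ2 hl)
        (mul_pos hκ0 hl) (h1.trans h2.symm))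
    · rintro rfl
      linarith

/-! #### The ordered spectrum -/

/-- A strictly increasing enumeration of the eigenvalues makes each infimum in the recursion an
attained minimum. -/
theorem energy_eq_of_strictMono {σ L : ℝ} {E : ℕ → ℝ} (hE : StrictMono E)
    (h : ∀ e, IsEnergyLevel σ L e ↔ e ∈ Set.range E) (k : ℕ) : energy σ L k = E k := by
  induction k with
  | zero =>
    refine IsLeast.csInf_eq ⟨(h _).mpr ⟨0, rfl⟩, fun e he => ?_⟩
    obtain ⟨j, rfl⟩ := (h e).mp he
    exact hE.monotone (Nat.zero_le j)
  | succ k ih =>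
    refine IsLeast.csInf_eq ⟨⟨(h _).mpr ⟨k + 1, rfl⟩, ih ▸ hE (Nat.lt_succ_self k)⟩,
      fun e he => ?_⟩
    obtain ⟨j, rfl⟩ := (h e).mp he.1
    have h2 := he.2
    rw [ih] at h2
    exact hE.monotone (Nat.succ_le_of_lt (hE.lt_iff_lt.mp h2))

/-- The energies of a system with `L |σ| > 2`. -/
theorem energy_spec {σ L : ℝ} (hσ : σ < 0) (hL : 2 < L * |σ|) :
    StrictMono (energy σ L) ∧ energy σ L 0 < -σ ^ 2 ∧
      -energy σ L 0 * Real.tanh (|σ| * (L / 2)) ^ 2 ≤ σ ^ 2 ∧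
      -σ ^ 2 < energy σ L 1 ∧ energy σ L 1 < 0 ∧
      ∀ k : ℕ, ((k + 1) * Real.pi / L) ^ 2 < energy σ L (k + 2) ∧
        energy σ L (k + 2) < ((k + 2) * Real.pi / L) ^ 2 := by
  have hpi := Real.pi_pos
  have hs : 0 < |σ| := abs_pos.mpr hσ.ne
  have hL0 : 0 < L := by
    by_contra! h
    nlinarith
  have hl : 0 < L / 2 := half_pos hL0
  have ha1 : 1 < |σ| * (L / 2) := by linarith
  obtain ⟨κ₀, h01, h02, h03⟩ := exists_even_level hs hl
  obtain ⟨κ₁, h11, h12, h13⟩ := exists_odd_level hs hl ha1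
  choose θ hθ0 hθ using exists_levelPhase_eq ha1
  have hbounds : ∀ k : ℕ, ((k : ℝ) + 1) * Real.pi / 2 < θ k ∧
      θ k < ((k : ℝ) + 2) * Real.pi / 2 := fun k => by
    have h1 := lt_levelPhase (zero_lt_one.trans ha1) (hθ0 k)
    have h2 := levelPhase_lt (|σ| * (L / 2)) (θ k)
    rw [hθ] at h1 h2
    exact ⟨by linarith, h1⟩
  have hsq2 : |σ| ^ 2 = σ ^ 2 := sq_abs σ
  set E : ℕ → ℝ := fun k => match k with
    | 0 => -κ₀ ^ 2
    | 1 => -κ₁ ^ 2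
    | k + 2 => (θ k / (L / 2)) ^ 2 with hEdef
  have hE2 : ∀ k : ℕ, (((k : ℝ) + 1) * Real.pi / L) ^ 2 < E (k + 2) ∧
      E (k + 2) < (((k : ℝ) + 2) * Real.pi / L) ^ 2 := fun k => by
    obtain ⟨h1, h2⟩ := hbounds k
    constructor
    · refine pow_lt_pow_left₀ ?_ (by positivity) two_ne_zero
      rw [div_lt_div_iff₀ hL0 hl]
      nlinarith
    · refine pow_lt_pow_left₀ ?_ (div_pos (hθ0 k) hl).le two_ne_zero
      rw [div_lt_div_iff₀ hl hL0]
      nlinarith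
  have hE01 : E 0 < E 1 := by
    change -κ₀ ^ 2 < -κ₁ ^ 2
    have : κ₁ ^ 2 < κ₀ ^ 2 := pow_lt_pow_left₀ (h12.trans h01) h11.le two_ne_zero
    linarith
  have hE1 : E 1 < 0 := by
    change -κ₁ ^ 2 < 0
    have : 0 < κ₁ ^ 2 := by positivity
    linarith
  have hmono : StrictMono E := strictMono_nat_of_lt_succ fun k => by
    match k with
    | 0 => exact hE01
    | 1 => exact hE1.trans ((sq_nonneg _).trans_lt (hE2 0).1)
    | k + 2 =>
      have h1 := (hE2 (k + 1)).1
      push_cast at h1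
      rw [add_assoc, one_add_one_eq_two] at h1
      exact (hE2 k).2.trans h1
  have hrange : ∀ e, IsEnergyLevel σ L e ↔ e ∈ Set.range E := by
    have hneg : ∀ κ, 0 < κ → (IsEnergyLevel σ L (-κ ^ 2) ↔ κ = κ₁ ∨ κ = κ₀) := fun κ hκ => by
      rw [isEnergyLevel_neg_sq_iff hL0 hκ, ← abs_of_neg hσ, h13 κ hκ, h03 κ hκ]
    intro e
    constructor
    · intro he
      rcases lt_trichotomy e 0 with h | h | h
      · have h1 : e = -Real.sqrt (-e) ^ 2 := by rw [Real.sq_sqrt (by linarith)]; ring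
        rw [h1] at he
        rcases (hneg _ (Real.sqrt_pos.mpr (by linarith))).mp he with h2 | h2
        · exact ⟨1, by rw [h1, h2]⟩
        · exact ⟨0, by rw [h1, h2]⟩
      · rw [h, isEnergyLevel_zero_iff hσ hL0] at he
        linarith
      · have h1 : e = Real.sqrt e ^ 2 := (Real.sq_sqrt h.le).symm
        have h0 := Real.sqrt_pos.mpr h
        rw [h1, isEnergyLevel_sq_iff_levelPhase hσ hL hL0 h0] at he
        obtain ⟨j, hj⟩ := he
        rw [← hθ j] at hj
        have h2 := (strictMonoOn_levelPhase ha1).injOn (mul_pos h0 hl) (hθ0 j) hj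
        refine ⟨j + 2, ?_⟩
        change (θ j / (L / 2)) ^ 2 = e
        rw [← h2, mul_div_assoc, div_self hl.ne', mul_one, Real.sq_sqrt h.le]
    · rintro ⟨k, rfl⟩
      match k with
      | 0 => exact (hneg κ₀ (hs.trans h01)).mpr (Or.inr rfl)
      | 1 => exact (hneg κ₁ h11).mpr (Or.inl rfl)
      | k + 2 =>
        refine (isEnergyLevel_sq_iff_levelPhase hσ hL hL0 (div_pos (hθ0 k) hl)).mpr ⟨k, ?_⟩
        rw [div_mul_cancel₀ _ hl.ne', hθ]
  have heq : energy σ L = E := funext (energy_eq_of_strictMono hmono hrange)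
  rw [heq]
  refine ⟨hmono, ?_, ?_, ?_, hE1, hE2⟩
  · change -κ₀ ^ 2 < _
    have : |σ| ^ 2 < κ₀ ^ 2 := pow_lt_pow_left₀ h01 hs.le two_ne_zero
    linarith
  · change - -κ₀ ^ 2 * _ ≤ _
    have h1 := tanh_pos (mul_pos hs hl)
    have : (κ₀ * Real.tanh (|σ| * (L / 2))) ^ 2 ≤ |σ| ^ 2 :=
      pow_le_pow_left₀ (mul_pos (hs.trans h01) h1).le h02 2
    rw [hsq2, mul_pow] at this
    linarith
  · change _ < -κ₁ ^ 2
    have : κ₁ ^ 2 < |σ| ^ 2 := pow_lt_pow_left₀ h12 h11.le two_ne_zero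
    linarith

/-- The ground state energy converges to `-σ²`. -/
theorem eventually_lt_energy_zero {σ : ℝ} (hσ : σ < 0) {δ : ℝ} (hδ : 0 < δ) :
    ∀ᶠ L in atTop, -σ ^ 2 - δ < energy σ L 0 := by
  have hs : 0 < |σ| := abs_pos.mpr hσ.ne
  have h1 : Tendsto (fun L : ℝ => (σ ^ 2 + δ) * Real.tanh (|σ| * (L / 2)) ^ 2) atTop
      (𝓝 ((σ ^ 2 + δ) * 1 ^ 2)) :=
    ((tendsto_tanh_atTop.comp
      ((tendsto_id.atTop_div_const two_pos).const_mul_atTop hs)).pow 2).const_mul _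
  have h2 : σ ^ 2 < (σ ^ 2 + δ) * 1 ^ 2 := by linarith
  filter_upwards [h1.eventually_const_lt h2, eventually_gt_atTop (2 / |σ|)] with L h3 h4
  obtain ⟨-, -, h5, -⟩ := energy_spec hσ ((div_lt_iff₀ hs).mp h4)
  by_contra! h6
  have := mul_le_mul_of_nonneg_right (show σ ^ 2 + δ ≤ -energy σ L 0 by linarith)
    (sq_nonneg (Real.tanh (|σ| * (L / 2))))
  linarith

/-! ### The density of the ideal gas and the mean-field equation -/

/-- The Bose-Einstein occupation of momentum `k` at chemical potential `ν`. -/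
noncomputable def boseOccupation (β ν k : ℝ) : ℝ := 1 / (Real.exp (β * (k ^ 2 - ν)) - 1)

/-- The particle density of the ideal Bose gas on the line. -/
noncomputable def boseDensity (β ν : ℝ) : ℝ :=
  1 / Real.pi * ∫ k in Set.Ioi (0 : ℝ), boseOccupation β ν k

theorem one_lt_exp_mul {β ν k : ℝ} (hβ : 0 < β) (hν : ν < 0) :
    1 < Real.exp (β * (k ^ 2 - ν)) :=
  Real.one_lt_exp_iff.mpr (mul_pos hβ (by nlinarith [sq_nonneg k]))

theorem boseOccupation_pos {β ν : ℝ} (hβ : 0 < β) (hν : ν < 0) (k : ℝ) :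
    0 < boseOccupation β ν k :=
  one_div_pos.mpr (sub_pos.mpr (one_lt_exp_mul hβ hν))

theorem inv_exp_sub_one_anti {x y : ℝ} (hx : 0 < x) (hxy : x ≤ y) :
    1 / (Real.exp y - 1) ≤ 1 / (Real.exp x - 1) :=
  one_div_le_one_div_of_le (sub_pos.mpr (Real.one_lt_exp_iff.mpr hx))
    (sub_le_sub_right (Real.exp_le_exp.mpr hxy) 1)

theorem boseOccupation_mono {β ν ν' : ℝ} (hβ : 0 < β) (h : ν ≤ ν') (hν : ν' < 0) (k : ℝ) :
    boseOccupation β ν k ≤ boseOccupation β ν' k :=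
  inv_exp_sub_one_anti (mul_pos hβ (by nlinarith [sq_nonneg k]))
    (mul_le_mul_of_nonneg_left (by linarith) hβ.le)

theorem boseOccupation_anti {β ν : ℝ} (hβ : 0 < β) (hν : ν < 0) :
    AntitoneOn (boseOccupation β ν) (Set.Ici 0) := fun x hx y _ hxy =>
  inv_exp_sub_one_anti (mul_pos hβ (by nlinarith [sq_nonneg x]))
    (mul_le_mul_of_nonneg_left (sub_le_sub_right (pow_le_pow_left₀ hx hxy 2) _) hβ.le)

theorem continuous_boseOccupation {β ν : ℝ} (hβ : 0 < β) (hν : ν < 0) :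
    Continuous (boseOccupation β ν) :=
  continuous_const.div (by fun_prop) fun _ => (sub_pos.mpr (one_lt_exp_mul hβ hν)).ne'

theorem integrableOn_boseOccupation {β ν : ℝ} (hβ : 0 < β) (hν : ν < 0) :
    IntegrableOn (boseOccupation β ν) (Set.Ioi 0) := by
  have hc : 0 < Real.exp (-(β * ν)) - 1 :=
    sub_pos.mpr (Real.one_lt_exp_iff.mpr (by nlinarith))
  have h := ((integrable_exp_neg_mul_sq hβ).div_const (Real.exp (-(β * ν)) - 1)).integrableOn
    (s := Set.Ioi 0)
  refine h.mono' (continuous_boseOccupation hβ hν).aestronglyMeasurable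
    (ae_of_all _ fun k => ?_)
  rw [Real.norm_of_nonneg (boseOccupation_pos hβ hν k).le, boseOccupation,
    div_le_div_iff₀ (sub_pos.mpr (one_lt_exp_mul hβ hν)) hc]
  have h1 : Real.exp (-β * k ^ 2) * Real.exp (β * (k ^ 2 - ν)) = Real.exp (-(β * ν)) := by
    rw [← Real.exp_add]
    ring_nf
  have h2 : Real.exp (-β * k ^ 2) ≤ 1 := Real.exp_le_one_iff.mpr (by nlinarith [sq_nonneg k])
  linarith

theorem boseDensity_nonneg {β ν : ℝ} (hβ : 0 < β) (hν : ν < 0) : 0 ≤ boseDensity β ν :=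
  mul_nonneg (by positivity)
    (setIntegral_nonneg measurableSet_Ioi fun k _ => (boseOccupation_pos hβ hν k).le)

theorem boseDensity_mono {β ν ν' : ℝ} (hβ : 0 < β) (h : ν ≤ ν') (hν : ν' < 0) :
    boseDensity β ν ≤ boseDensity β ν' :=
  mul_le_mul_of_nonneg_left
    (setIntegral_mono (integrableOn_boseOccupation hβ (h.trans_lt hν))
      (integrableOn_boseOccupation hβ hν) fun k => boseOccupation_mono hβ h hν k) (by positivity)

theorem continuousAt_boseDensity {β ν : ℝ} (hβ : 0 < β) (hν : ν < 0) :
    ContinuousAt (boseDensity β) ν := by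
  refine continuousAt_const.mul ?_
  -- The occupation at `ν / 2`, still negative, dominates the integrand for all chemical potentials
  -- near `ν`.
  have hν2 : ν / 2 < 0 := by linarith
  have hnear : ∀ᶠ x in 𝓝 ν, x < ν / 2 := eventually_lt_nhds (by linarith)
  refine continuousAt_of_dominated (bound := boseOccupation β (ν / 2)) ?_ ?_
    (integrableOn_boseOccupation hβ hν2) ?_
  · filter_upwards [hnear] with x hx
    exact (continuous_boseOccupation hβ (hx.trans hν2)).aestronglyMeasurable
  · filter_upwards [hnear] with x hx
    refine ae_of_all _ fun k => ?_
    rw [Real.norm_of_nonneg (boseOccupation_pos hβ (hx.trans hν2) k).le]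
    exact boseOccupation_mono hβ hx.le hν2 k
  · refine ae_of_all _ fun k => ?_
    exact continuousAt_const.div (by fun_prop) (sub_pos.mpr (one_lt_exp_mul hβ hν)).ne'

/-- At low temperature the density at fixed negative chemical potential is of order `1 / β`. -/
theorem boseDensity_le_div {β ν : ℝ} (hβ : 1 ≤ β) (hν : ν < 0) :
    boseDensity β ν ≤ boseDensity 1 ν / β := by
  have hβ0 : 0 < β := zero_lt_one.trans_le hβ
  have h : ∀ k, boseOccupation β ν k ≤ boseOccupation 1 ν k / β := fun k => by
    have h1 := one_lt_exp_mul (k := k) one_pos hν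
    -- Bernoulli's inequality gives `e^{βy} - 1 ≥ β (e^y - 1)` for `β ≥ 1`.
    have h2 := one_add_mul_self_le_rpow_one_add
      (show -1 ≤ Real.exp (1 * (k ^ 2 - ν)) - 1 by linarith) hβ
    rw [add_sub_cancel, ← Real.exp_mul] at h2
    rw [boseOccupation, boseOccupation, div_div]
    refine one_div_le_one_div_of_le (mul_pos (by linarith) hβ0) ?_
    rw [show β * (k ^ 2 - ν) = 1 * (k ^ 2 - ν) * β by ring]
    linarith
  rw [boseDensity, boseDensity, mul_div_assoc, ← integral_div]
  exact mul_le_mul_of_nonneg_left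
    (setIntegral_mono (integrableOn_boseOccupation hβ0 hν)
      ((integrableOn_boseOccupation one_pos hν).div_const β) h) (by positivity)

/-- A density of states comparison: the total occupation of levels interlaced with the squares of
the multiples of `π / L` is `L` times the density up to a bounded error. -/
theorem tsum_boseOccupation_bounds {β ν L : ℝ} (hβ : 0 < β) (hν : ν < 0) (hL : 0 < L)
    {p : ℕ → ℝ} (hp : ∀ k : ℕ, ((k : ℝ) + 1) * Real.pi / L ≤ p k ∧
      p k ≤ ((k : ℝ) + 2) * Real.pi / L) :
    Summable (fun k => boseOccupation β ν (p k)) ∧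
      ∑' k, boseOccupation β ν (p k) ≤ L * boseDensity β ν ∧
      L * boseDensity β ν - 2 * boseOccupation β ν 0 ≤ ∑' k, boseOccupation β ν (p k) := by
  have hpi := Real.pi_pos
  have hh : 0 < Real.pi / L := div_pos hpi hL
  obtain ⟨f, hf⟩ : ∃ f : ℝ → ℝ, f = fun x => boseOccupation β ν (Real.pi / L * x) := ⟨_, rfl⟩
  have hanti : AntitoneOn f (Set.Ici 0) := fun x hx y hy hxy => by
    rw [hf]
    exact boseOccupation_anti hβ hν (mul_nonneg hh.le hx) (mul_nonneg hh.le hy)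
      (mul_le_mul_of_nonneg_left hxy hh.le)
  have hpos : ∀ x, 0 ≤ f x := fun x => by
    rw [hf]
    exact (boseOccupation_pos hβ hν _).le
  have hint : IntegrableOn f (Set.Ioi 0) := by
    rw [hf, integrableOn_Ioi_comp_mul_left_iff _ _ hh, mul_zero]
    exact integrableOn_boseOccupation hβ hν
  have hval : ∫ x in Set.Ioi 0, f x = L * boseDensity β ν := by
    rw [hf, integral_comp_mul_left_Ioi _ _ hh, mul_zero, boseDensity, smul_eq_mul]
    field_simp
  have hsum : Summable fun n : ℕ => f n :=
    hanti.summable_of_integrableOn_Ioi_zero hint fun x _ => hpos x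
  have h1 := hanti.tsum_add_one_le_integral hint fun x _ => hpos x
  have h2 := hanti.integral_le_tsum hsum fun x _ => hpos x
  have hs1 : Summable fun n : ℕ => f (n + 1 : ℕ) := (summable_nat_add_iff 1).mpr hsum
  have hs2 : Summable fun n : ℕ => f (n + 2 : ℕ) := (summable_nat_add_iff 2).mpr hsum
  have hp0 : ∀ k, 0 ≤ p k := fun k => le_trans (by positivity) (hp k).1
  have hup : ∀ k : ℕ, boseOccupation β ν (p k) ≤ f (k + 1 : ℕ) := fun k => by
    have h : Real.pi / L * ((k + 1 : ℕ) : ℝ) = ((k : ℝ) + 1) * Real.pi / L := by push_cast; ring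
    rw [hf]
    simp only [h]
    exact boseOccupation_anti hβ hν (by simp only [Set.mem_Ici]; positivity) (hp0 k) (hp k).1
  have hlow : ∀ k : ℕ, f (k + 2 : ℕ) ≤ boseOccupation β ν (p k) := fun k => by
    have h : Real.pi / L * ((k + 2 : ℕ) : ℝ) = ((k : ℝ) + 2) * Real.pi / L := by push_cast; ring
    rw [hf]
    simp only [h]
    exact boseOccupation_anti hβ hν (hp0 k) (by simp only [Set.mem_Ici]; positivity) (hp k).2
  have hs : Summable fun k => boseOccupation β ν (p k) :=
    Summable.of_nonneg_of_le (fun k => (boseOccupation_pos hβ hν _).le) hup hs1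
  refine ⟨hs, ?_, ?_⟩
  · rw [← hval]
    exact (hs.tsum_le_tsum hup hs1).trans h1
  · have h3 := hs2.tsum_le_tsum hlow hs
    -- The levels start at index 2 of the Riemann sum, so the lower bound loses its first two terms,
    -- each at most the occupation at momentum 0.
    have h4 := hsum.sum_add_tsum_nat_add 2
    rw [Finset.sum_range_succ, Finset.sum_range_one] at h4
    have h5 : f (0 : ℕ) = boseOccupation β ν 0 := by simp [hf]
    have h6 : f (1 : ℕ) ≤ f (0 : ℕ) := hanti (by simp) (by simp) (by simp)
    rw [hval] at h2
    linarith

/-- The density of the excited particles: a solution `x` of the mean-field equation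
`x = boseDensity β (μ - lam x)`. -/
noncomputable def excitedDensity (lam β μ : ℝ) : ℝ :=
  Classical.epsilon fun x => 0 ≤ x ∧ x = boseDensity β (μ - lam * x)

/-- The function `x - D(μ - lam x)` is nonpositive at 0 and, by monotonicity of `D`, nonnegative at
`x = D(μ)`. -/
theorem excitedDensity_spec {lam β μ : ℝ} (hlam : 0 < lam) (hβ : 0 < β) (hμ : μ < 0) :
    0 ≤ excitedDensity lam β μ ∧
      excitedDensity lam β μ = boseDensity β (μ - lam * excitedDensity lam β μ) := by
  refine Classical.epsilon_spec (p := fun x => 0 ≤ x ∧ x = boseDensity β (μ - lam * x)) ?_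
  have hD := boseDensity_nonneg hβ hμ
  have hneg : ∀ x, 0 ≤ x → μ - lam * x < 0 := fun x hx => by nlinarith
  have hcont : ContinuousOn (fun x => x - boseDensity β (μ - lam * x))
      (Set.Icc 0 (boseDensity β μ)) := fun x hx =>
    (continuousAt_id.sub (ContinuousAt.comp (f := fun x => μ - lam * x)
      (continuousAt_boseDensity hβ (hneg x hx.1)) (by fun_prop))).continuousWithinAt
  obtain ⟨x, hx, h⟩ := intermediate_value_Icc hD hcont
    (show (0 : ℝ) ∈ Set.Icc _ _ from ⟨by simpa using hD,
      sub_nonneg.mpr (boseDensity_mono hβ (by nlinarith) hμ)⟩)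
  exact ⟨x, hx.1, sub_eq_zero.mp h⟩

theorem excitedDensity_le_boseDensity {lam β μ : ℝ} (hlam : 0 < lam) (hβ : 0 < β) (hμ : μ < 0) :
    excitedDensity lam β μ ≤ boseDensity β μ := by
  obtain ⟨h0, h1⟩ := excitedDensity_spec hlam hβ hμ
  rw [h1]
  exact boseDensity_mono hβ (by nlinarith) hμ

theorem excitedDensity_mono {lam β μ μ' : ℝ} (hlam : 0 < lam) (hβ : 0 < β) (h : μ ≤ μ')
    (hμ : μ' < 0) : excitedDensity lam β μ ≤ excitedDensity lam β μ' := by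
  obtain ⟨h0, h1⟩ := excitedDensity_spec hlam hβ (h.trans_lt hμ)
  obtain ⟨h0', h1'⟩ := excitedDensity_spec hlam hβ hμ
  by_contra! hlt
  have := boseDensity_mono hβ (show μ - lam * excitedDensity lam β μ ≤
    μ' - lam * excitedDensity lam β μ' by nlinarith) (by nlinarith)
  linarith

/-- If `x` grew faster than `μ / lam`, the effective potential `μ - lam x` would decrease, and with
it `D(μ - lam x) = x`, a contradiction. -/
theorem excitedDensity_lipschitz {lam β μ μ' : ℝ} (hlam : 0 < lam) (hβ : 0 < β) (h : μ ≤ μ')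
    (hμ : μ' < 0) :
    lam * (excitedDensity lam β μ' - excitedDensity lam β μ) ≤ μ' - μ := by
  obtain ⟨h0, h1⟩ := excitedDensity_spec hlam hβ (h.trans_lt hμ)
  obtain ⟨h0', h1'⟩ := excitedDensity_spec hlam hβ hμ
  by_contra! hlt
  have := boseDensity_mono hβ (show μ' - lam * excitedDensity lam β μ' ≤
    μ - lam * excitedDensity lam β μ by linarith) (by nlinarith)
  nlinarith

/-! ### Estimates in the grand canonical state -/

/-- The fugacity `exp (-β (ε_k - μ))` of the mode `k`, with the positive energies raised by `θ`. -/
noncomputable def fugacity (σ β L μ θ : ℝ) (k : ℕ) : ℝ :=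
  Real.exp (-β * (energy σ L k - μ + θ * excitedIndicator k))

section fugacity

variable {σ β L μ θ : ℝ}

theorem fugacity_nonneg (k : ℕ) : 0 ≤ fugacity σ β L μ θ k := (Real.exp_pos _).le

theorem fugacity_lt_one (hσ : σ < 0) (hβ : 0 < β) (hL : 2 < L * |σ|) (hμ : μ < energy σ L 0)
    (hθ : 0 ≤ θ) (k : ℕ) : fugacity σ β L μ θ k < 1 := by
  have h1 := (energy_spec hσ hL).1.monotone (Nat.zero_le k)
  have h2 := mul_nonneg hθ (excitedIndicator_nonneg k)
  exact Real.exp_lt_one_iff.mpr (by nlinarith)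

theorem fugacity_div_one_sub (σ β L μ θ : ℝ) (k : ℕ) :
    fugacity σ β L μ θ k / (1 - fugacity σ β L μ θ k) =
      1 / (Real.exp (β * (energy σ L k - μ + θ * excitedIndicator k)) - 1) := by
  rw [fugacity, neg_mul, Real.exp_neg]
  have h := Real.exp_pos (β * (energy σ L k - μ + θ * excitedIndicator k))
  rw [← one_div, div_div, mul_sub, mul_one, mul_one_div_cancel h.ne']

/-- Raising the positive energies by `θ` amounts to free particles at chemical potential `μ - θ`,
which links these modes to the ideal-gas density. -/
theorem fugacity_div_one_sub_excited (hσ : σ < 0) (hL : 2 < L * |σ|) (k : ℕ) :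
    fugacity σ β L μ θ (k + 2) / (1 - fugacity σ β L μ θ (k + 2)) =
      boseOccupation β (μ - θ) (Real.sqrt (energy σ L (k + 2))) := by
  have h := ((sq_nonneg _).trans_lt ((energy_spec hσ hL).2.2.2.2.2 k).1).le
  rw [fugacity_div_one_sub, boseOccupation, Real.sq_sqrt h, excitedIndicator, if_pos (by omega)]
  ring_nf

theorem sqrt_energy_bounds (hσ : σ < 0) (hL0 : 0 < L) (hL : 2 < L * |σ|) (k : ℕ) :
    ((k : ℝ) + 1) * Real.pi / L ≤ Real.sqrt (energy σ L (k + 2)) ∧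
      Real.sqrt (energy σ L (k + 2)) ≤ ((k : ℝ) + 2) * Real.pi / L := by
  have hpi := Real.pi_pos
  obtain ⟨h1, h2⟩ := (energy_spec hσ hL).2.2.2.2.2 k
  exact ⟨Real.le_sqrt_of_sq_le h1.le, Real.sqrt_le_iff.mpr ⟨by positivity, h2.le⟩⟩

theorem pos_of_two_lt_mul_abs (hL : 2 < L * |σ|) : 0 < L := by
  by_contra! h
  nlinarith [abs_nonneg σ]

theorem summable_fugacity (hσ : σ < 0) (hβ : 0 < β) (hL : 2 < L * |σ|) (hμ : μ < energy σ L 0)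
    (hθ : 0 ≤ θ) : Summable (fugacity σ β L μ θ) := by
  have hL0 := pos_of_two_lt_mul_abs hL
  have hν : μ - θ < 0 := by nlinarith [(energy_spec hσ hL).2.1, sq_nonneg σ]
  rw [← summable_nat_add_iff 2]
  refine Summable.of_nonneg_of_le (fun k => fugacity_nonneg _) (fun k => ?_)
    (tsum_boseOccupation_bounds hβ hν hL0 (sqrt_energy_bounds hσ hL0 hL)).1
  rw [← fugacity_div_one_sub_excited hσ hL]
  have h1 := fugacity_lt_one hσ hβ hL hμ hθ (k + 2)
  have h0 := fugacity_nonneg (σ := σ) (β := β) (L := L) (μ := μ) (θ := θ) (k + 2)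
  exact le_div_self h0 (by linarith) (by linarith)

theorem tsum_excited_fugacity (hσ : σ < 0) (hβ : 0 < β) (hL : 2 < L * |σ|)
    (hμ : μ < energy σ L 0) (hθ : 0 ≤ θ) :
    ∑' k, excitedIndicator k * (fugacity σ β L μ θ k / (1 - fugacity σ β L μ θ k)) =
      ∑' k, boseOccupation β (μ - θ) (Real.sqrt (energy σ L (k + 2))) := by
  have hs := summable_excitedIndicator_mul
    (fun k => div_nonneg (fugacity_nonneg k) (sub_pos.mpr (fugacity_lt_one hσ hβ hL hμ hθ k)).le)
    (summable_div_one_sub fugacity_nonneg (summable_fugacity hσ hβ hL hμ hθ))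
  have h := hs.sum_add_tsum_nat_add 2
  rw [← h, Finset.sum_range_succ, Finset.sum_range_one]
  simp only [fugacity_div_one_sub_excited hσ hL]
  simp [excitedIndicator]

end fugacity

/-- Completing the square in the Gibbs weight around the excited particle number `L x`. -/
theorem exp_gibbsExponent_eq (σ lam β μ x : ℝ) {L : ℝ} (hL : 0 < L) (n : Occupation) :
    Real.exp (gibbsExponent σ lam β μ L n) =
      Real.exp (β * lam / (2 * L) * (L * x) ^ 2) *
        (Real.exp (-(β * lam / (2 * L)) * (excitedCount n - L * x) ^ 2) *
          productWeight (fugacity σ β L μ (lam * x)) n) := by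
  have h1 : weightedCount (fun k => -β * (energy σ L k - μ + lam * x * excitedIndicator k)) n =
      -β * (weightedCount (energy σ L) n - μ * totalCount n + lam * x * excitedCount n) := by
    have h2 : (fun k => energy σ L k - μ + lam * x * excitedIndicator k) =
        fun k => (energy σ L k + -μ * 1) + lam * x * excitedIndicator k := by
      funext k
      ring
    rw [weightedCount_smul, h2, weightedCount_add, weightedCount_add, weightedCount_smul,
      weightedCount_smul]
    ring
  unfold fugacity
  rw [productWeight_eq_exp, h1, ← Real.exp_add, ← Real.exp_add, gibbsExponent]
  congr 1
  simp only [totalCount, excitedCount]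
  field_simp
  ring

/-- The mean of an observable in the grand canonical state. -/
noncomputable def gibbsMean (σ lam β μ L : ℝ) (x : Occupation → ℝ) : ℝ :=
  (∑' n, x n * Real.exp (gibbsExponent σ lam β μ L n)) /
    ∑' n, Real.exp (gibbsExponent σ lam β μ L n)

section means

variable {σ lam β μ L : ℝ}

theorem exp_gibbsExponent_eq_mul (hL : 0 < L) (n : Occupation) :
    Real.exp (gibbsExponent σ lam β μ L n) =
      Real.exp (-(β * lam / (2 * L)) * excitedCount n ^ 2) *
        productWeight (fugacity σ β L μ 0) n := by
  simpa using exp_gibbsExponent_eq σ lam β μ 0 hL n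

theorem exp_neg_sq_le_one (hlam : 0 < lam) (hβ : 0 < β) (hL : 0 < L) (y : ℝ) :
    Real.exp (-(β * lam / (2 * L)) * y ^ 2) ≤ 1 := by
  rw [Real.exp_le_one_iff, neg_mul, neg_nonpos]
  positivity

theorem summable_mul_exp_gibbsExponent (hσ : σ < 0) (hlam : 0 < lam) (hβ : 0 < β)
    (hL : 2 < L * |σ|) (hμ : μ < energy σ L 0) {G : Occupation → ℝ}
    (hG : ∀ n, |G n| ≤ 1 + totalCount n) :
    Summable fun n => G n * Real.exp (gibbsExponent σ lam β μ L n) := by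
  have hL0 := pos_of_two_lt_mul_abs hL
  simp only [exp_gibbsExponent_eq_mul hL0, ← mul_assoc]
  refine summable_mul_productWeight fugacity_nonneg (fugacity_lt_one hσ hβ hL hμ le_rfl)
    (summable_fugacity hσ hβ hL hμ le_rfl) (C := 1) fun n => ?_
  rw [abs_mul, Real.abs_exp]
  have h0 := totalCount_nonneg n
  calc |G n| * Real.exp (-(β * lam / (2 * L)) * excitedCount n ^ 2) ≤ |G n| :=
        mul_le_of_le_one_right (abs_nonneg _) (exp_neg_sq_le_one hlam hβ hL0 _)
    _ ≤ 1 + totalCount n := hG n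
    _ ≤ 1 * (1 + totalCount n) ^ 2 := by nlinarith

theorem tsum_exp_gibbsExponent_pos (hσ : σ < 0) (hlam : 0 < lam) (hβ : 0 < β)
    (hL : 2 < L * |σ|) (hμ : μ < energy σ L 0) :
    0 < ∑' n, Real.exp (gibbsExponent σ lam β μ L n) := by
  have h := summable_mul_exp_gibbsExponent hσ hlam hβ hL hμ (G := fun _ => 1)
    (fun n => by simpa using totalCount_nonneg n)
  simp only [one_mul] at h
  exact h.tsum_pos (fun n => (Real.exp_pos _).le) 0 (Real.exp_pos _)

/-- Modes 0 and 1 do not enter `Ñ`, so the interaction factor is invariant under adding such a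
particle and the ideal Bose law is exact. -/
theorem gibbsMean_number_of_lt (hσ : σ < 0) (hlam : 0 < lam) (hβ : 0 < β)
    (hL : 2 < L * |σ|) (hμ : μ < energy σ L 0) {k : ℕ} (hk : k < 2) :
    gibbsMean σ lam β μ L (fun n => (n k : ℝ)) =
      1 / (Real.exp (β * (energy σ L k - μ)) - 1) := by
  have hL0 := pos_of_two_lt_mul_abs hL
  rw [gibbsMean, div_eq_iff (tsum_exp_gibbsExponent_pos hσ hlam hβ hL hμ).ne']
  simp only [exp_gibbsExponent_eq_mul hL0, ← mul_assoc]
  rw [tsum_apply_mul_of_shift_eq fugacity_nonneg (fugacity_lt_one hσ hβ hL hμ le_rfl)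
    (summable_fugacity hσ hβ hL hμ le_rfl) k
    (fun n => by rw [Real.abs_exp]; exact exp_neg_sq_le_one hlam hβ hL0 _)
    (fun n => by
      rw [excitedCount, weightedCount_add_single, excitedIndicator, if_neg (by omega), add_zero]),
    fugacity_div_one_sub, zero_mul, add_zero]

theorem gibbsMean_number_le (hσ : σ < 0) (hlam : 0 < lam) (hβ : 0 < β)
    (hL : 2 < L * |σ|) (hμ : μ < energy σ L 0) (k : ℕ) :
    gibbsMean σ lam β μ L (fun n => (n k : ℝ)) ≤
      1 / (Real.exp (β * (energy σ L k - μ)) - 1) := by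
  have hL0 := pos_of_two_lt_mul_abs hL
  rw [gibbsMean, div_le_iff₀ (tsum_exp_gibbsExponent_pos hσ hlam hβ hL hμ)]
  simp only [exp_gibbsExponent_eq_mul hL0, ← mul_assoc]
  refine (tsum_apply_mul_le_of_shift_le fugacity_nonneg (fugacity_lt_one hσ hβ hL hμ le_rfl)
    (summable_fugacity hσ hβ hL hμ le_rfl) k (fun n => (Real.exp_pos _).le)
    (fun n => exp_neg_sq_le_one hlam hβ hL0 _) (fun n => ?_)).trans_eq ?_
  · rw [Real.exp_le_exp, excitedCount, weightedCount_add_single, neg_mul, neg_mul, neg_le_neg_iff]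
    have h0 := excitedCount_nonneg n
    exact mul_le_mul_of_nonneg_left
      (pow_le_pow_left₀ h0 (le_add_of_nonneg_right (excitedIndicator_nonneg k)) 2) (by positivity)
  · rw [fugacity_div_one_sub, zero_mul, add_zero]

theorem gibbsMean_nonneg {x : Occupation → ℝ} (hx : ∀ n, 0 ≤ x n) :
    0 ≤ gibbsMean σ lam β μ L x :=
  div_nonneg (tsum_nonneg fun n => mul_nonneg (hx n) (Real.exp_pos _).le)
    (tsum_nonneg fun _ => (Real.exp_pos _).le)

theorem gibbsMean_add (hσ : σ < 0) (hlam : 0 < lam) (hβ : 0 < β)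
    (hL : 2 < L * |σ|) (hμ : μ < energy σ L 0) {x y : Occupation → ℝ}
    (hx : ∀ n, |x n| ≤ 1 + totalCount n) (hy : ∀ n, |y n| ≤ 1 + totalCount n) :
    gibbsMean σ lam β μ L (fun n => x n + y n) =
      gibbsMean σ lam β μ L x + gibbsMean σ lam β μ L y := by
  simp only [gibbsMean, add_mul]
  rw [(summable_mul_exp_gibbsExponent hσ hlam hβ hL hμ hx).tsum_add
    (summable_mul_exp_gibbsExponent hσ hlam hβ hL hμ hy), add_div]

/-- Concentration of the number of excited particles at the solution of the mean-field
equation. -/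
theorem abs_gibbsMean_excitedCount_sub_le (hσ : σ < 0) (hlam : 0 < lam) (hβ : 0 < β)
    (hL1 : 1 ≤ L) (hL : 2 < L * |σ|) (hμ : μ < energy σ L 0) {B A : ℝ}
    (hB : B = boseOccupation β (-σ ^ 2) 0)
    (hA : A = boseDensity β (-σ ^ 2) * (1 + B) + 4 * B ^ 2 + 1) :
    |gibbsMean σ lam β μ L excitedCount - L * excitedDensity lam β μ| ≤
      Real.sqrt (L * A) * Real.exp (β * lam / 2 * A) := by
  have hL0 := pos_of_two_lt_mul_abs hL
  have hσ2 : -σ ^ 2 < 0 := by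
    have := sq_pos_of_neg hσ
    linarith
  have hμσ : μ < -σ ^ 2 := hμ.trans (energy_spec hσ hL).2.1
  have hμ0 : μ < 0 := hμσ.trans hσ2
  obtain ⟨hx0, hx⟩ := excitedDensity_spec hlam hβ hμ0
  set x := excitedDensity lam β μ with hxdef
  have hθ : 0 ≤ lam * x := mul_nonneg hlam.le hx0
  have hν : μ - lam * x < 0 := by linarith
  have ht0 : ∀ k, 0 ≤ fugacity σ β L μ (lam * x) k := fugacity_nonneg
  have ht1 := fugacity_lt_one (θ := lam * x) hσ hβ hL hμ hθ
  have hts := summable_fugacity (θ := lam * x) hσ hβ hL hμ hθ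
  obtain ⟨-, hup, hlow⟩ := tsum_boseOccupation_bounds hβ hν hL0 (sqrt_energy_bounds hσ hL0 hL)
  rw [← tsum_excited_fugacity hσ hβ hL hμ hθ, ← hx] at hup hlow
  have hB0 : 0 < B := hB ▸ boseOccupation_pos hβ hσ2 0
  have hBν : boseOccupation β (μ - lam * x) 0 ≤ B :=
    hB ▸ boseOccupation_mono hβ (by linarith) hσ2 0
  have hbB : ∀ k, 2 ≤ k → fugacity σ β L μ (lam * x) k / (1 - fugacity σ β L μ (lam * x) k) ≤ B := by
    intro k hk
    obtain ⟨j, rfl⟩ := Nat.exists_eq_add_of_le' hk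
    rw [fugacity_div_one_sub_excited hσ hL]
    exact (boseOccupation_anti hβ hν (Set.mem_Ici.mpr le_rfl) (Real.sqrt_nonneg _)
      (Real.sqrt_nonneg _)).trans hBν
  have hmean := tsum_excitedCount_productWeight ht0 ht1 hts
  have hsq := tsum_excitedCount_sq_le ht0 ht1 hts hbB
  have hxD : x ≤ boseDensity β (-σ ^ 2) := by
    rw [hx]
    exact boseDensity_mono hβ (by linarith) hσ2
  have hD0 := boseDensity_nonneg hβ hσ2
  have hsum0 := summable_productWeight ht0 ht1 hts
  have hsum1 : Summable fun n => excitedCount n * productWeight (fugacity σ β L μ (lam * x)) n := by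
    refine summable_mul_productWeight ht0 ht1 hts (C := 1) fun n => ?_
    rw [abs_of_nonneg (excitedCount_nonneg n)]
    nlinarith [excitedCount_le_totalCount n, totalCount_nonneg n]
  have hsum2 : Summable fun n =>
      excitedCount n ^ 2 * productWeight (fugacity σ β L μ (lam * x)) n := by
    refine summable_mul_productWeight ht0 ht1 hts (C := 1) fun n => ?_
    rw [abs_of_nonneg (sq_nonneg _), one_mul]
    exact pow_le_pow_left₀ (excitedCount_nonneg n) (by linarith [excitedCount_le_totalCount n]) 2
  have hZ := tsum_productWeight_pos ht0 ht1 hts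
  set v := productWeight (fugacity σ β L μ (lam * x)) with hv
  have hv0 : ∀ n, 0 ≤ v n := productWeight_nonneg ht0
  set Z := ∑' n, v n with hZdef
  set M := ∑' k, excitedIndicator k *
    (fugacity σ β L μ (lam * x) k / (1 - fugacity σ β L μ (lam * x) k)) with hM
  have hexpand : ∀ n, (excitedCount n - L * x) ^ 2 * v n =
      excitedCount n ^ 2 * v n - 2 * (L * x) * (excitedCount n * v n) + (L * x) ^ 2 * v n :=
    fun n => by ring
  have hYs : Summable fun n => (excitedCount n - L * x) ^ 2 * v n := by
    simp only [hexpand]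
    exact (hsum2.sub (hsum1.mul_left _)).add (hsum0.mul_left _)
  have hA1 : 1 ≤ A := by
    rw [hA]
    have : 0 ≤ boseDensity β (-σ ^ 2) * (1 + B) := by positivity
    nlinarith [sq_nonneg B]
  have hYle : ∑' n, (excitedCount n - L * x) ^ 2 * v n ≤ L * A * Z := by
    simp only [hexpand]
    rw [(hsum2.sub (hsum1.mul_left _)).tsum_add (hsum0.mul_left _),
      hsum2.tsum_sub (hsum1.mul_left _), tsum_mul_left, tsum_mul_left, hmean, ← hZdef]
    -- The mean-field equation makes `L x` the Riemann-sum approximation of `M`, with error at most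
    -- `2 B`.
    have h1 : (M - L * x) ^ 2 ≤ 4 * B ^ 2 := by nlinarith
    have h2 : M * (1 + B) ≤ L * (boseDensity β (-σ ^ 2) * (1 + B)) := by
      rw [← mul_assoc]
      exact mul_le_mul_of_nonneg_right
        (hup.trans (mul_le_mul_of_nonneg_left hxD hL0.le)) (by linarith)
    have h3 : M * (1 + B) + (M - L * x) ^ 2 ≤ L * A := by
      rw [hA]
      nlinarith [sq_nonneg B]
    have h4 := mul_le_mul_of_nonneg_right h3 hZ.le
    linarith
  -- The tilt rate is of order `1/L` and the second moment of order `L`, so their product is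
  -- independent of `L` and only `√(L A)` grows.
  have hkey := abs_tsum_mul_exp_neg_sq_le (Y := fun n => excitedCount n - L * x)
    (c := β * lam / (2 * L)) hv0 hsum0 hYs (by positivity) (by positivity : 0 < L * A) hYle
  have hcA : β * lam / (2 * L) * (L * A) = β * lam / 2 * A := by field_simp
  rw [hcA] at hkey
  have hW := exp_gibbsExponent_eq σ lam β μ x hL0
  rw [← hv] at hW
  set K := Real.exp (β * lam / (2 * L) * (L * x) ^ 2) with hK
  have hK0 : 0 < K := Real.exp_pos _
  have hWpos := tsum_exp_gibbsExponent_pos hσ hlam hβ hL hμ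
  have hWsum : ∑' n, Real.exp (gibbsExponent σ lam β μ L n) =
      K * ∑' n, Real.exp (-(β * lam / (2 * L)) * (excitedCount n - L * x) ^ 2) * v n := by
    rw [← tsum_mul_left]
    exact tsum_congr hW
  have hdiff : gibbsMean σ lam β μ L excitedCount - L * x =
      (∑' n, (excitedCount n - L * x) *
        Real.exp (-(β * lam / (2 * L)) * (excitedCount n - L * x) ^ 2) * v n) * K /
        ∑' n, Real.exp (gibbsExponent σ lam β μ L n) := by
    rw [gibbsMean, div_sub' hWpos.ne']
    congr 1
    have hs0 := summable_mul_exp_gibbsExponent hσ hlam hβ hL hμ (G := fun _ => 1)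
      (fun n => by simpa using totalCount_nonneg n)
    have hs1 := summable_mul_exp_gibbsExponent hσ hlam hβ hL hμ (G := excitedCount)
      (fun n => by
        rw [abs_of_nonneg (excitedCount_nonneg n)]; linarith [excitedCount_le_totalCount n])
    simp only [one_mul] at hs0
    rw [mul_comm (∑' n, Real.exp _), ← tsum_mul_left, ← hs1.tsum_sub (hs0.mul_left _),
      ← tsum_mul_right]
    refine tsum_congr fun n => ?_
    rw [hW n]
    ring
  rw [hdiff, abs_div, abs_mul, abs_of_pos hK0, abs_of_pos hWpos, div_le_iff₀ hWpos, hWsum]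
  have h5 := mul_le_mul_of_nonneg_right hkey hK0.le
  calc _ ≤ _ := h5
    _ = _ := by ring

end means

/-! ### The condensate density -/

theorem gibbs_eq_gibbsMean {X : FockOp} {x : Occupation → ℝ} (hX : ActsDiagonally X x)
    (σ lam β μ L : ℝ) : gibbs σ lam β μ L X = (gibbsMean σ lam β μ L x : ℂ) :=
  gibbs_eq hX σ lam β μ L

/-- On occupations of the ground mode alone `Ñ = 0`, so the partition function contains a geometric
series of ratio `exp (-β (ε_0 - μ))`. -/
theorem IsChemicalPotential.lt_energy_zero {σ lam β ρ L μ : ℝ} (hβ : 0 < β)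
    (h : IsChemicalPotential σ lam β ρ L μ) : μ < energy σ L 0 := by
  have hs := (summable_diagExp_iff actsDiagonally_one
    (actsDiagonally_exponent σ lam β μ L)).mp h.1
  have hg := hs.comp_injective (Finsupp.single_injective (M := ℕ) (0 : ℕ))
  have hpow : ((fun n => 1 * Real.exp (gibbsExponent σ lam β μ L n)) ∘
      fun j : ℕ => (Finsupp.single 0 j : Occupation)) =
      fun j : ℕ => Real.exp (-β * (energy σ L 0 - μ)) ^ j := by
    funext j
    simp only [Function.comp_apply, one_mul, gibbsExponent, weightedCount_single,
      ← Real.exp_nat_mul]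
    congr 1
    simp [excitedIndicator]
    ring
  rw [hpow, summable_geometric_iff_norm_lt_one, Real.norm_of_nonneg (Real.exp_pos _).le,
    Real.exp_lt_one_iff] at hg
  by_contra! hlt
  nlinarith

theorem IsChemicalPotential.gibbsMean_totalCount {σ lam β ρ L μ : ℝ} (hL : 0 < L)
    (h : IsChemicalPotential σ lam β ρ L μ) : gibbsMean σ lam β μ L totalCount = ρ * L := by
  have h2 := h.2.2
  rw [totalNumber, gibbs_eq_gibbsMean (actsDiagonally_modeSum fun _ => 1),
    div_eq_iff (by exact_mod_cast hL.ne')] at h2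
  exact_mod_cast h2

/-- The condensate density of the imperfect Bose gas with attractive boundary conditions. -/
noncomputable def condensateDensity (σ lam β ρ : ℝ) : ℝ :=
  max 0 (ρ - excitedDensity lam β (-σ ^ 2))

section limit

variable {σ lam β ρ : ℝ}

/-- Particle conservation plus concentration of `Ñ` give `N₀ / L ≈ ρ - x(μ_L)`. The lower bound
follows from `x(μ_L) ≤ x_c` and nonnegativity, the upper one from a case split on the distance of
`μ_L` to `-σ²`; no convergence of `μ_L` is needed. -/
theorem tendsto_condensate (hσ : σ < 0) (hlam : 0 < lam) (hβ : 0 < β) {μ : ℝ → ℝ}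
    (hμ : ∀ᶠ L in atTop, IsChemicalPotential σ lam β ρ L (μ L)) :
    Tendsto (fun L => gibbsMean σ lam β (μ L) L (fun n => (n 0 : ℝ) + n 1) / L) atTop
      (𝓝 (condensateDensity σ lam β ρ)) := by
  have hs : 0 < |σ| := abs_pos.mpr hσ.ne
  have hσ2 : -σ ^ 2 < 0 := by
    have := sq_pos_of_neg hσ
    linarith
  obtain ⟨B, hB⟩ : ∃ B, B = boseOccupation β (-σ ^ 2) 0 := ⟨_, rfl⟩
  obtain ⟨A, hA⟩ : ∃ A, A = boseDensity β (-σ ^ 2) * (1 + B) + 4 * B ^ 2 + 1 := ⟨_, rfl⟩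
  have herr : Tendsto (fun L : ℝ => Real.sqrt (L * A) * Real.exp (β * lam / 2 * A) / L) atTop
      (𝓝 0) := by
    have h1 : Tendsto (fun L : ℝ => Real.sqrt A * Real.exp (β * lam / 2 * A) * (Real.sqrt L)⁻¹)
        atTop (𝓝 (Real.sqrt A * Real.exp (β * lam / 2 * A) * 0)) :=
      (tendsto_inv_atTop_zero.comp Real.tendsto_sqrt_atTop).const_mul _
    rw [mul_zero] at h1
    refine h1.congr' ?_
    filter_upwards [eventually_gt_atTop 0] with L hL
    rw [Real.sqrt_mul hL.le, ← Real.sqrt_div_self]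
    ring
  rw [Metric.tendsto_nhds]
  intro ε hε
  -- If `μ_L ≥ -σ² - 2δ`, the Lipschitz bound gives `x_c - x ≤ 2δ / lam = ε / 2`.
  obtain ⟨δ, hδ⟩ : ∃ δ, δ = lam * ε / 4 := ⟨_, rfl⟩
  have hδ0 : 0 < δ := by rw [hδ]; positivity
  have hb : Tendsto (fun L : ℝ => 2 / (Real.exp (β * δ) - 1) / L) atTop (𝓝 0) :=
    tendsto_const_nhds.div_atTop tendsto_id
  filter_upwards [hμ, herr.eventually_lt_const (half_pos hε), hb.eventually_lt_const hε,
    eventually_lt_energy_zero hσ hδ0, eventually_gt_atTop (2 / |σ|), eventually_ge_atTop 1]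
    with L hμL herrL hbL henergy hL2 hL1
  have hL : 2 < L * |σ| := (div_lt_iff₀ hs).mp hL2
  have hL0 : 0 < L := by linarith
  have hμ0 := hμL.lt_energy_zero hβ
  have hμσ : μ L < -σ ^ 2 := hμ0.trans (energy_spec hσ hL).2.1
  have hμneg : μ L < 0 := hμσ.trans hσ2
  have hb0 : ∀ n : Occupation, |(n 0 : ℝ)| ≤ 1 + totalCount n := fun n => by
    rw [Nat.abs_cast]
    linarith [apply_le_weightedCount_one n 0]
  have hb1 : ∀ n : Occupation, |(n 1 : ℝ)| ≤ 1 + totalCount n := fun n => by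
    rw [Nat.abs_cast]
    linarith [apply_le_weightedCount_one n 1]
  have hb01 : ∀ n : Occupation, |(n 0 : ℝ) + n 1| ≤ 1 + totalCount n := fun n => by
    rw [abs_of_nonneg (by positivity)]
    linarith [totalCount_eq n, excitedCount_nonneg n]
  have hbe : ∀ n : Occupation, |excitedCount n| ≤ 1 + totalCount n := fun n => by
    rw [abs_of_nonneg (excitedCount_nonneg n)]
    linarith [excitedCount_le_totalCount n]
  have htotal : gibbsMean σ lam β (μ L) L (fun n => (n 0 : ℝ) + n 1) +
      gibbsMean σ lam β (μ L) L excitedCount = ρ * L := by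
    rw [← hμL.gibbsMean_totalCount hL0, ← gibbsMean_add hσ hlam hβ hL hμ0 hb01 hbe]
    congr 1
    funext n
    exact (totalCount_eq n).symm
  have hnonneg : 0 ≤ gibbsMean σ lam β (μ L) L (fun n => (n 0 : ℝ) + n 1) :=
    gibbsMean_nonneg fun n => by positivity
  -- Since `ε_L(0) > -σ² - δ`, both low modes then have gap at least `δ`, hence an occupation
  -- bounded independently of `L`.
  have hsmall : μ L < -σ ^ 2 - 2 * δ →
      gibbsMean σ lam β (μ L) L (fun n => (n 0 : ℝ) + n 1) ≤ 2 / (Real.exp (β * δ) - 1) := by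
    intro hlt
    have h10 := (energy_spec hσ hL).1 Nat.zero_lt_one
    rw [gibbsMean_add hσ hlam hβ hL hμ0 hb0 hb1,
      gibbsMean_number_of_lt hσ hlam hβ hL hμ0 (by norm_num),
      gibbsMean_number_of_lt hσ hlam hβ hL hμ0 (by norm_num)]
    have h0 := inv_exp_sub_one_anti (mul_pos hβ hδ0)
      (mul_le_mul_of_nonneg_left (show δ ≤ energy σ L 0 - μ L by linarith) hβ.le)
    have h1 := inv_exp_sub_one_anti (mul_pos hβ hδ0)
      (mul_le_mul_of_nonneg_left (show δ ≤ energy σ L 1 - μ L by linarith) hβ.le)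
    calc _ ≤ 1 / (Real.exp (β * δ) - 1) + 1 / (Real.exp (β * δ) - 1) := add_le_add h0 h1
      _ = _ := by ring
  have hconc := abs_gibbsMean_excitedCount_sub_le hσ hlam hβ hL1 hL hμ0 hB hA
  set N₀ := gibbsMean σ lam β (μ L) L (fun n => (n 0 : ℝ) + n 1) with hN₀
  set x := excitedDensity lam β (μ L) with hx
  set xc := excitedDensity lam β (-σ ^ 2) with hxc
  have hdist : |N₀ / L - (ρ - x)| < ε / 2 := by
    have h1 : N₀ / L - (ρ - x) = -((gibbsMean σ lam β (μ L) L excitedCount - L * x) / L) := by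
      rw [← eq_sub_iff_add_eq] at htotal
      rw [htotal]
      field_simp
      ring
    rw [h1, abs_neg, abs_div, abs_of_pos hL0]
    exact (div_le_div_of_nonneg_right hconc hL0.le).trans_lt herrL
  have hxle : x ≤ xc := excitedDensity_mono hlam hβ hμσ.le hσ2
  have hN₀L : 0 ≤ N₀ / L := div_nonneg hnonneg hL0.le
  rw [Real.dist_eq, condensateDensity, ← hxc]
  rw [abs_lt] at hdist ⊢
  constructor
  · rcases max_cases 0 (ρ - xc) with h | h <;> linarith
  · have hm0 := le_max_left 0 (ρ - xc)
    have hm1 := le_max_right 0 (ρ - xc)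
    rcases lt_or_ge (μ L) (-σ ^ 2 - 2 * δ) with hlt | hge
    · have := div_le_div_of_nonneg_right (hsmall hlt) hL0.le
      linarith
    · have hlip : lam * (xc - x) ≤ -σ ^ 2 - μ L := excitedDensity_lipschitz hlam hβ hμσ.le hσ2
      have : lam * (xc - x) ≤ lam * (ε / 2) := by
        rw [hδ] at hge
        linarith
      have := le_of_mul_le_mul_left this hlam
      linarith

/-- Positive levels lie more than `σ²` above `μ_L`, so one bound `1 / (e^{βσ²} - 1)` on the
occupation serves all `k ≥ 2` and all large `L`. -/
theorem eventually_gibbsMean_number_lt (hσ : σ < 0) (hlam : 0 < lam) (hβ : 0 < β) {μ : ℝ → ℝ}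
    (hμ : ∀ᶠ L in atTop, IsChemicalPotential σ lam β ρ L (μ L)) {ε : ℝ} (hε : 0 < ε) :
    ∀ᶠ L in atTop, 0 < L ∧ ∀ k : ℕ, 2 ≤ k →
      gibbsMean σ lam β (μ L) L (fun n => (n k : ℝ)) / L < ε := by
  have hs : 0 < |σ| := abs_pos.mpr hσ.ne
  have hb : Tendsto (fun L : ℝ => 1 / (Real.exp (β * σ ^ 2) - 1) / L) atTop (𝓝 0) :=
    tendsto_const_nhds.div_atTop tendsto_id
  filter_upwards [hμ, hb.eventually_lt_const hε, eventually_gt_atTop (2 / |σ|)]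
    with L hμL hbL hL2
  have hL : 2 < L * |σ| := (div_lt_iff₀ hs).mp hL2
  have hL0 := pos_of_two_lt_mul_abs hL
  have hμ0 := hμL.lt_energy_zero hβ
  have h0 := (energy_spec hσ hL).2.1
  refine ⟨hL0, fun k hk => (div_le_div_of_nonneg_right ?_ hL0.le).trans_lt hbL⟩
  refine (gibbsMean_number_le hσ hlam hβ hL hμ0 k).trans
    (inv_exp_sub_one_anti (mul_pos hβ (sq_pos_of_neg hσ))
      (mul_le_mul_of_nonneg_left ?_ hβ.le))
  obtain ⟨j, rfl⟩ := Nat.exists_eq_add_of_le' hk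
  have := (sq_nonneg _).trans_lt ((energy_spec hσ hL).2.2.2.2.2 j).1
  linarith

end limit

end ImperfectBoseGas

/-! ### Assembly of the main theorem -/

theorem mainTheorem1 (σ lam : ℝ) (hσ : σ < 0) (hlam : 0 < lam) :
    -- the modes `0` and `1` are exactly the negative-energy ones
    (∀ L : ℝ, 2 < L * |σ| →
      ImperfectBoseGas.energy σ L 0 < ImperfectBoseGas.energy σ L 1 ∧
      ImperfectBoseGas.energy σ L 1 < 0 ∧
      ∀ k : ℕ, 2 ≤ k → 0 < ImperfectBoseGas.energy σ L k) ∧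
    -- the condensate density as a function of `β` and `ρ`
    ∃ ρcond : ℝ → ℝ → ℝ,
      (∀ β ρ : ℝ, 0 < β → 0 < ρ → ∀ μ : ℝ → ℝ,
        (∀ᶠ L in atTop, ImperfectBoseGas.IsChemicalPotential σ lam β ρ L (μ L)) →
        Tendsto (fun L : ℝ => (1 / (L : ℂ)) * ImperfectBoseGas.gibbs σ lam β (μ L) L
            (ImperfectBoseGas.number 0 + ImperfectBoseGas.number 1))
          atTop (𝓝 (ρcond β ρ : ℂ)) ∧
        -- no mode of positive energy is macroscopically occupied
        ∀ ε : ℝ, 0 < ε → ∀ᶠ L : ℝ in atTop, ∀ k : ℕ, 2 ≤ k →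
          ‖(1 / (L : ℂ)) * ImperfectBoseGas.gibbs σ lam β (μ L) L
            (ImperfectBoseGas.number k)‖ < ε) ∧
      (∀ β : ℝ, 0 < β →
        IntegrableOn (fun k : ℝ => 1 / (Real.exp (β * (k ^ 2 + σ ^ 2)) - 1)) (Set.Ioi 0)) ∧
      (∀ β ρ : ℝ, 0 < β → 0 < ρ →
        ρ - (1 / Real.pi) *
            ∫ k in Set.Ioi (0 : ℝ), 1 / (Real.exp (β * (k ^ 2 + σ ^ 2)) - 1) ≤ ρcond β ρ) ∧
      (∀ β : ℝ, 0 < β → ∃ ρ₀ : ℝ, ∀ ρ : ℝ, 0 < ρ → ρ₀ ≤ ρ → 0 < ρcond β ρ) ∧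
      (∀ ρ : ℝ, 0 < ρ → ∃ β₀ : ℝ, ∀ β : ℝ, 0 < β → β₀ ≤ β → 0 < ρcond β ρ) := by
  open ImperfectBoseGas in
  have hσ2 : -σ ^ 2 < 0 := by
    have := sq_pos_of_neg hσ
    linarith
  have hocc : ∀ β : ℝ, (fun k : ℝ => 1 / (Real.exp (β * (k ^ 2 + σ ^ 2)) - 1)) =
      boseOccupation β (-σ ^ 2) := fun β => by
    funext k
    rw [boseOccupation, sub_neg_eq_add]
  have hbound : ∀ β ρ : ℝ, 0 < β →
      ρ - boseDensity β (-σ ^ 2) ≤ condensateDensity σ lam β ρ := fun β ρ hβ =>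
    (sub_le_sub_left (excitedDensity_le_boseDensity hlam hβ hσ2) ρ).trans (le_max_right _ _)
  refine ⟨fun L hL => ?_, condensateDensity σ lam, fun β ρ hβ _ μ hμ => ⟨?_, fun ε hε => ?_⟩,
    fun β hβ => ?_, fun β ρ hβ _ => ?_, fun β hβ => ?_, fun ρ hρ => ?_⟩
  · obtain ⟨hmono, -, -, -, h1, h2⟩ := energy_spec hσ hL
    refine ⟨hmono Nat.zero_lt_one, h1, fun k hk => ?_⟩
    obtain ⟨j, rfl⟩ := Nat.exists_eq_add_of_le' hk
    exact (sq_nonneg _).trans_lt (h2 j).1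
  · have h := (Complex.continuous_ofReal.tendsto _).comp (tendsto_condensate hσ hlam hβ hμ)
    refine h.congr fun L => ?_
    rw [gibbs_eq_gibbsMean ((actsDiagonally_number 0).add (actsDiagonally_number 1)),
      Function.comp_apply, Complex.ofReal_div]
    ring
  · filter_upwards [eventually_gibbsMean_number_lt hσ hlam hβ hμ hε] with L hL k hk
    rw [gibbs_eq_gibbsMean (actsDiagonally_number k), one_div_mul_eq_div, ← Complex.ofReal_div,
      Complex.norm_real, Real.norm_of_nonneg
        (div_nonneg (gibbsMean_nonneg fun n => Nat.cast_nonneg _) hL.1.le)]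
    exact hL.2 k hk
  · rw [hocc]
    exact integrableOn_boseOccupation hβ hσ2
  · rw [hocc]
    exact hbound β ρ hβ
  · refine ⟨boseDensity β (-σ ^ 2) + 1, fun ρ _ h => ?_⟩
    linarith [hbound β ρ hβ]
  -- For `β ≥ 1` the density `D(-σ²)` is at most its value at `β = 1` divided by `β`, hence below
  -- `ρ` past this threshold.
  · refine ⟨max 1 (boseDensity 1 (-σ ^ 2) / ρ + 1), fun β hβ h => ?_⟩
    have h1 := boseDensity_le_div ((le_max_left _ _).trans h) hσ2
    have h2 : boseDensity 1 (-σ ^ 2) / ρ < β := by linarith [(le_max_right _ _).trans h]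
    have h3 : boseDensity 1 (-σ ^ 2) / β < ρ := by
      rw [div_lt_iff₀ hρ] at h2
      rw [div_lt_iff₀ hβ]
      linarith
    linarith [hbound β ρ hβ]
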